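/- Let $\mathcal A_v$ be the Cayley-Dickson algebra of real dimension $2^v$ ($\mathcal A_0=\mathbb R$, and $\mathcal A_{v+1}$ is the double of $\mathcal A_v$ with product $(a+bl)(c+dl)=(ac-d^*b)+(da+bc^*)l$ and conjugation $(a+bl)^*=a^*-bl$), with its Euclidean norm, with $z^{-1}=z^*/|z|^2$ for $z\ne 0$, and with $\exp$ and $\sin$ given by their power series. Let $\Gamma$ be the Gamma function on $\mathcal A_v$: $\Gamma(z)=\int_0^\infty e^{-t}t^{z-1}\,dt$, $t^{z-1}=\exp((z-1)\ln t)$, wherever this integral converges, continued $\mathcal A_v$-holomorphically to $\mathcal A_v\setminus\{0,-1,-2,\dots\}$ (a function is $\mathcal A_v$-holomorphic if near each point $z_0$ it is the sum of a normally convergent series of words in $z-z_0$ with coefficients in $\mathcal A_v$). Let $M\in\mathcal A_v$ be purely imaginary with $|M|=1$. Let $\psi$ be a locally rectifiable loop in $(\mathbb R\oplus M\mathbb R)\setminus\{0\}$ that starts at $-\infty$ of the real axis, encircles $0$ once in the positive direction (from $1$ towards $M$) and returns to $-\infty$; that is, $|\psi|\to\infty$ at both ends and a continuous argument $\theta$ along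 $\psi$, with $\psi=|\psi|e^{\theta M}$, tends to $-\pi$ at the start and to $\pi$ at the end. Along $\psi$ let $\zeta^{w}=\exp(w\,\mathrm{Ln}\,\zeta)$ with $\mathrm{Ln}\,\zeta=\ln|\zeta|+\theta M$ (the principal value as long as $-\pi\le\theta\le\pi$, with $\theta=\mp\pi$ on the lower and upper edge of the cut). Then for each $z\in(\mathbb R\oplus M\mathbb R)\setminus\mathbb Z$ the improper line integral $\int_\psi e^{\zeta}\zeta^{z-1}\,d\zeta$ converges and $$\Gamma(z)=(2\sin(\pi z))^{-1}\Bigl(\int_\psi e^{\zeta}\zeta^{z-1}\,d\zeta\Bigr)M^*.$$ -/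

import Mathlib

open MeasureTheory Filter Topology

noncomputable section

namespace CayleyDickson

/-- The Cayley-Dickson algebra `A_v` of real dimension `2 ^ v`: `A_0 = ℝ` and `A_(v+1)` is the
double of `A_v`, with the Euclidean norm of pairs. -/
def CD : ℕ → Type
  | 0 => ℝ
  | v + 1 => WithLp 2 (CD v × CD v)

instance instNormedAddCommGroup : (v : ℕ) → NormedAddCommGroup (CD v)
  | 0 => inferInstanceAs (NormedAddCommGroup ℝ)
  | v + 1 =>
    letI := instNormedAddCommGroup v
    inferInstanceAs (NormedAddCommGroup (WithLp 2 (CD v × CD v)))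

instance instNormedSpace : (v : ℕ) → NormedSpace ℝ (CD v)
  | 0 => inferInstanceAs (NormedSpace ℝ ℝ)
  | v + 1 =>
    letI := instNormedSpace v
    inferInstanceAs (NormedSpace ℝ (WithLp 2 (CD v × CD v)))

/-- The pair `a + b l` in the double of `A_v`. -/
def pair {v : ℕ} (a b : CD v) : CD (v + 1) := WithLp.toLp 2 (a, b)

/-- The component `a` of `a + b l`. -/
def left {v : ℕ} (z : CD (v + 1)) : CD v :=
  WithLp.fst (p := 2) (α := CD v) (β := CD v) z

/-- The component `b` of `a + b l`. -/
def right {v : ℕ} (z : CD (v + 1)) : CD v :=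
  WithLp.snd (p := 2) (α := CD v) (β := CD v) z

/-- Conjugation: the identity on `ℝ`, and `(a + b l)* = a* - b l`. -/
def conj : (v : ℕ) → CD v → CD v
  | 0 => fun a => a
  | v + 1 => fun z => pair (conj v (left z)) (-right z)

instance (v : ℕ) : Star (CD v) := ⟨conj v⟩

/-- The doubling product `(a + b l) (c + d l) = (a c - d* b) + (d a + b c*) l`. -/
def mul : (v : ℕ) → CD v → CD v → CD v
  | 0 => show ℝ → ℝ → ℝ from fun a b => a * b
  | v + 1 => fun z w =>
      pair (mul v (left z) (left w) - mul v (star (right w)) (right z))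
        (mul v (right w) (left z) + mul v (right z) (star (left w)))

instance (v : ℕ) : Mul (CD v) := ⟨mul v⟩

/-- The unit of `A_v`. -/
def one : (v : ℕ) → CD v
  | 0 => (1 : ℝ)
  | v + 1 => pair (one v) 0

instance (v : ℕ) : One (CD v) := ⟨one v⟩

/-- The copy of the real number `x` in `A_v`. -/
def ofReal (v : ℕ) (x : ℝ) : CD v := x • (1 : CD v)

/-- The inverse `z* / |z|^2` of `z ≠ 0`. -/
instance (v : ℕ) : Inv (CD v) := ⟨fun z => (‖z‖ ^ 2)⁻¹ • star z⟩

/-- Powers of a Cayley-Dickson number (the algebra is power-associative). -/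
def npow {v : ℕ} (z : CD v) : ℕ → CD v
  | 0 => 1
  | n + 1 => npow z n * z

/-- The exponential `∑ z^n / n!`. -/
def exp {v : ℕ} (z : CD v) : CD v :=
  ∑' n : ℕ, ((n.factorial : ℝ)⁻¹) • npow z n

/-- The sine `∑ (-1)^n z^(2n+1) / (2n+1)!`. -/
def sin {v : ℕ} (z : CD v) : CD v :=
  ∑' n : ℕ, ((-1 : ℝ) ^ n * ((2 * n + 1).factorial : ℝ)⁻¹) • npow z (2 * n + 1)

/-- The real part `(z + z*) / 2`, as an element of `A_v`. -/
def re {v : ℕ} (z : CD v) : CD v := (1 / 2 : ℝ) • (z + star z)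

/-- The purely imaginary numbers. -/
def imaginary (v : ℕ) : Set (CD v) := {z | re z = 0}

/-- The plane `ℝ ⊕ M ℝ`. -/
def slice {v : ℕ} (M : CD v) : Set (CD v) :=
  {z | ∃ x y : ℝ, z = ofReal v x + y • M}

/-- Words in one variable with coefficients in `A_v`: products, bracketed in any order, of
constants and the variable. -/
inductive Word (v : ℕ) : Type
  | var : Word v
  | const : CD v → Word v
  | mul : Word v → Word v → Word v

/-- The value of a word. -/
def Word.eval {v : ℕ} : Word v → CD v → CD v
  | .var, h => h
  | .const a, _ => a
  | .mul p q, h => p.eval h * q.eval h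

/-- `f` is `A_v`-holomorphic at `z₀`: on some ball around `z₀` it is the sum of a normally
convergent series of words in `z - z₀`. No word involves the conjugate of the variable, so for
`v = 1` this is complex analyticity. -/
def HolomorphicAt {v : ℕ} (f : CD v → CD v) (z₀ : CD v) : Prop :=
  ∃ r : ℝ, 0 < r ∧ ∃ (ι : Type) (w : ι → Word v) (b : ι → ℝ), Summable b ∧
    (∀ k h, ‖h‖ < r → ‖(w k).eval h‖ ≤ b k) ∧
    ∀ h, ‖h‖ < r → HasSum (fun k => (w k).eval h) (f (z₀ + h))

/-- The integrand `e^(-t) t^(z-1)`, where `t^(z-1) = exp ((z - 1) ln t)` for real `t > 0`. -/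
def gammaIntegrand {v : ℕ} (z : CD v) (t : ℝ) : CD v :=
  Real.exp (-t) • exp (Real.log t • (z - 1))

/-- `G` is given by Euler's integral wherever that converges, and is `A_v`-holomorphic at every
point other than `0, -1, -2, …`. -/
def IsGammaFunction {v : ℕ} (G : CD v → CD v) : Prop :=
  (∀ z, IntegrableOn (gammaIntegrand z) (Set.Ioi 0) →
    G z = ∫ t in Set.Ioi (0 : ℝ), gammaIntegrand z t) ∧
  ∀ z, (∀ n : ℕ, z ≠ ofReal v (-(n : ℝ))) → HolomorphicAt G z

open Classical in
/-- The Gamma function of `A_v`: Euler's integral where it converges and its `A_v`-holomorphic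
continuation elsewhere. Its values at the poles `0, -1, -2, …` are arbitrary. -/
def Gamma {v : ℕ} : CD v → CD v :=
  if h : ∃ G : CD v → CD v, IsGammaFunction G then h.choose else fun _ => 0

/-- A loop in `(ℝ ⊕ M ℝ) \ {0}`, locally rectifiable, that starts at `-∞` on the real axis,
encircles `0` once in the positive direction and returns to `-∞`. The direction of rotation is
the one from `1` to `M`. The continuous argument `arg` goes from `-π` to `π`. The
ends may run along the lower and the upper edge of the cut `(-∞, 0]` or approach `-∞`
asymptotically. -/
structure HankelLoop {v : ℕ} (M : CD v) where
  /-- the parametrized loop -/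
  path : ℝ → CD v
  /-- the argument along the loop -/
  arg : ℝ → ℝ
  path_ne_zero : ∀ t, path t ≠ 0
  path_eq : ∀ t, path t = ‖path t‖ • exp (arg t • M)
  continuous_path : Continuous path
  continuous_arg : Continuous arg
  rectifiable : LocallyBoundedVariationOn path Set.univ
  norm_start : Tendsto (fun t => ‖path t‖) atBot atTop
  norm_end : Tendsto (fun t => ‖path t‖) atTop atTop
  arg_start : Tendsto arg atBot (𝓝 (-Real.pi))
  arg_end : Tendsto arg atTop (𝓝 Real.pi)

/-- The branch `ln |ζ| + arg(ζ) M` of `Ln ζ` at the point `ζ = ψ(t)`; it is the principal value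
as long as the argument lies between `-π` and `π`. -/
def HankelLoop.Ln {v : ℕ} {M : CD v} (ψ : HankelLoop M) (t : ℝ) : CD v :=
  ofReal v (Real.log ‖ψ.path t‖) + ψ.arg t • M

/-- The power `ζ^w = exp (w Ln ζ)` at the point `ζ = ψ(t)`. -/
def HankelLoop.cpow {v : ℕ} {M : CD v} (ψ : HankelLoop M) (w : CD v) (t : ℝ) : CD v :=
  exp (w * ψ.Ln t)

/-- The line integral of `f` (given along the path `γ` as a function of the parameter) over the
arc `γ|[a, b]` exists and equals `I`: the sums `∑ f(τ_j) (γ(s_(j+1)) - γ(s_j))` tend to `I` as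
the mesh of the tagged partition tends to `0`. -/
def HasLineIntegral {v : ℕ} (f γ : ℝ → CD v) (a b : ℝ) (I : CD v) : Prop :=
  ∀ ε : ℝ, 0 < ε → ∃ δ : ℝ, 0 < δ ∧ ∀ (n : ℕ) (s τ : ℕ → ℝ), s 0 = a → s n = b →
    (∀ j < n, s j ≤ τ j ∧ τ j ≤ s (j + 1) ∧ s (j + 1) - s j < δ) →
    ‖(∑ j ∈ Finset.range n, f (τ j) * (γ (s (j + 1)) - γ (s j))) - I‖ < ε

/-- The line integral over the whole path `γ : ℝ → A_v` exists and equals `I`: it exists over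
each arc, and tends to `I` as the arc exhausts the path. -/
def HasImproperLineIntegral {v : ℕ} (f γ : ℝ → CD v) (I : CD v) : Prop :=
  ∃ J : ℝ → ℝ → CD v, (∀ a b, a ≤ b → HasLineIntegral f γ a b (J a b)) ∧
    Tendsto (fun p : ℝ × ℝ => J p.1 p.2) (atBot ×ˢ atTop) (𝓝 I)

end CayleyDickson

end

noncomputable section

namespace CayleyDickson

/-! An imaginary unit satisfies M² = -1, so `phi M`, x + iy ↦ x + yM, embeds ℂ isometrically and
multiplicatively, carrying exp, sin, inverse and conjugation along. On one plane the failure of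
associativity is invisible. Two tasks remain: Hankel's integral in ℂ, and the identification of
`Gamma` on the plane with the complex Γ.

Hankel's integral. With ζ = e^s the loop lifts to a path whose real part tends to +∞ at both ends
while its imaginary part goes from -π to π, and e^ζ ζ^(w-1) dζ becomes the entire form exp(e^s + ws)
ds. With a primitive K, the integral over an arc is a difference of values of K
(`HankelLoop.hasLineIntegral`), and the improper integral is the difference of the limits of K at
the two ends. For Re w > 0 the form on the edges Im s = ±π is e^(±iπw) times Euler's integrand in t
= e^x, and the values of K on the two edges merge as Re s → -∞. The difference is therefore 2i
sin(πw) Γ(w). Integration by parts extends this to all non-integral w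
(`hankel_formula_of_primitive`).

The Gamma function. `Gamma` is chosen among the solutions of `IsGammaFunction`, so uniqueness and
existence are both needed. Uniqueness on planes (`IsGammaFunction.apply_phi`): a word series
restricted to a real line is a power series, so the identity theorem propagates Euler's integral.
Existence (`isGammaFunction_gammaFun`): the complex Γ is transplanted to every plane. Its Taylor
series is a word series when its coefficients lie in all planes involved. Otherwise the dimension is
at least 4, conjugation is a finite sum of words, and real analyticity is enough. -/

variable {v : ℕ} {M : CD v}

/-! ### Algebra of the Cayley-Dickson doubling -/

theorem ext_pair {z w : CD (v + 1)} (h₁ : left z = left w) (h₂ : right z = right w) : z = w :=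
  WithLp.ofLp_injective 2 (Prod.ext h₁ h₂)

@[simp] theorem left_pair (a b : CD v) : left (pair a b) = a := rfl
@[simp] theorem right_pair (a b : CD v) : right (pair a b) = b := rfl
@[simp] theorem left_add (z w : CD (v + 1)) : left (z + w) = left z + left w := rfl
@[simp] theorem right_add (z w : CD (v + 1)) : right (z + w) = right z + right w := rfl
@[simp] theorem left_neg (z : CD (v + 1)) : left (-z) = -left z := rfl
@[simp] theorem right_neg (z : CD (v + 1)) : right (-z) = -right z := rfl
@[simp] theorem left_zero : left (0 : CD (v + 1)) = 0 := rfl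
@[simp] theorem right_zero : right (0 : CD (v + 1)) = 0 := rfl
@[simp] theorem left_smul (c : ℝ) (z : CD (v + 1)) : left (c • z) = c • left z := rfl
@[simp] theorem right_smul (c : ℝ) (z : CD (v + 1)) : right (c • z) = c • right z := rfl
@[simp] theorem left_one : left (1 : CD (v + 1)) = 1 := rfl
@[simp] theorem right_one : right (1 : CD (v + 1)) = 0 := rfl
@[simp] theorem left_star (z : CD (v + 1)) : left (star z) = star (left z) := rfl
@[simp] theorem right_star (z : CD (v + 1)) : right (star z) = -right z := rfl
@[simp] theorem left_mul (z w : CD (v + 1)) :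
    left (z * w) = left z * left w - star (right w) * right z := rfl
@[simp] theorem right_mul (z w : CD (v + 1)) :
    right (z * w) = right w * left z + right z * star (left w) := rfl

theorem norm_sq_eq (z : CD (v + 1)) : ‖z‖ ^ 2 = ‖left z‖ ^ 2 + ‖right z‖ ^ 2 :=
  WithLp.prod_norm_sq_eq_of_L2 (α := CD v) (β := CD v) z

theorem star_add' : ∀ {v : ℕ} (z w : CD v), star (z + w) = star z + star w
  | 0, _, _ => rfl
  | v + 1, z, w => ext_pair (by simp [star_add' (left z)]) (by simp; abel)

theorem star_smul' : ∀ {v : ℕ} (c : ℝ) (z : CD v), star (c • z) = c • star z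
  | 0, _, _ => rfl
  | v + 1, c, z => ext_pair (by simp [star_smul' c (left z)]) (by simp)

theorem star_neg' (z : CD v) : star (-z) = -star z := by
  simpa using star_smul' (-1) z

theorem star_zero' : star (0 : CD v) = 0 := by
  simpa using star_smul' 0 (0 : CD v)

theorem star_star' : ∀ {v : ℕ} (z : CD v), star (star z) = z
  | 0, _ => rfl
  | v + 1, z => ext_pair (by simp [star_star' (left z)]) (by simp)

theorem star_one' : ∀ {v : ℕ}, star (1 : CD v) = 1
  | 0 => rfl
  | v + 1 => ext_pair (by simp [star_one' (v := v)]) (by simp)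

/-- The doubling product swaps factors, so each law in the double uses both laws one level below;
hence the joint induction, here and in the next lemmas. -/
theorem distrib_aux : ∀ {v : ℕ} (x y z : CD v),
    (x + y) * z = x * z + y * z ∧ x * (y + z) = x * y + x * z
  | 0, x, y, z => ⟨_root_.add_mul (R := ℝ) x y z, _root_.mul_add (R := ℝ) x y z⟩
  | v + 1, x, y, z => by
    have hl : ∀ a b c : CD v, (a + b) * c = a * c + b * c := fun a b c => (distrib_aux a b c).1
    have hr : ∀ a b c : CD v, a * (b + c) = a * b + a * c := fun a b c => (distrib_aux a b c).2
    constructor <;> apply ext_pair <;> simp [hl, hr, star_add'] <;> abel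

theorem smul_mul_aux : ∀ {v : ℕ} (c : ℝ) (x y : CD v),
    (c • x) * y = c • (x * y) ∧ x * (c • y) = c • (x * y)
  | 0, c, x, y => ⟨_root_.mul_assoc (G := ℝ) c x y, _root_.mul_left_comm (G := ℝ) x c y⟩
  | v + 1, c, x, y => by
    have hl : ∀ (c : ℝ) (a b : CD v), (c • a) * b = c • (a * b) :=
      fun c a b => (smul_mul_aux c a b).1
    have hr : ∀ (c : ℝ) (a b : CD v), a * (c • b) = c • (a * b) :=
      fun c a b => (smul_mul_aux c a b).2
    constructor <;> apply ext_pair <;> simp [hl, hr, star_smul', smul_sub]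

theorem one_aux : ∀ {v : ℕ} (x : CD v), (1 : CD v) * x = x ∧ x * (1 : CD v) = x ∧ x * 0 = 0
  | 0, x => ⟨_root_.one_mul (M := ℝ) x, _root_.mul_one (M := ℝ) x, MulZeroClass.mul_zero (M₀ := ℝ) x⟩
  | v + 1, x => by
    have h0 : ∀ a : CD v, a * 0 = 0 := fun a => (one_aux a).2.2
    have h0' : ∀ a : CD v, 0 * a = 0 := fun a => by
      simpa using (smul_mul_aux 0 (0 : CD v) a).1
    have hl : ∀ a : CD v, 1 * a = a := fun a => (one_aux a).1
    have hr : ∀ a : CD v, a * 1 = a := fun a => (one_aux a).2.1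
    refine ⟨?_, ?_, ?_⟩ <;> apply ext_pair <;> simp [hl, hr, h0, h0', star_one', star_zero']

scoped instance : NonAssocRing (CD v) :=
  { (inferInstance : AddCommGroup (CD v)), (inferInstance : Mul (CD v)),
    (inferInstance : One (CD v)) with
    left_distrib := fun x y z => (distrib_aux x y z).2
    right_distrib := fun x y z => (distrib_aux x y z).1
    zero_mul := fun x => by simpa using (smul_mul_aux 0 (0 : CD v) x).1
    mul_zero := fun x => (one_aux x).2.2
    one_mul := fun x => (one_aux x).1
    mul_one := fun x => (one_aux x).2.1 }

scoped instance : IsScalarTower ℝ (CD v) (CD v) := ⟨fun c x y => (smul_mul_aux c x y).1⟩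
scoped instance : SMulCommClass ℝ (CD v) (CD v) := ⟨fun c x y => ((smul_mul_aux c x y).2).symm⟩

scoped instance : StarAddMonoid (CD v) where
  star_involutive := star_star'
  star_add := star_add'

theorem finiteDimensional : ∀ v : ℕ, FiniteDimensional ℝ (CD v)
  | 0 => inferInstanceAs (FiniteDimensional ℝ ℝ)
  | v + 1 =>
    haveI := finiteDimensional v
    inferInstanceAs (FiniteDimensional ℝ (WithLp 2 (CD v × CD v)))

instance : FiniteDimensional ℝ (CD v) := finiteDimensional v
instance : CompleteSpace (CD v) := FiniteDimensional.complete ℝ (CD v)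

theorem norm_one' : ∀ {v : ℕ}, ‖(1 : CD v)‖ = 1
  | 0 => NormOneClass.norm_one (α := ℝ)
  | v + 1 => by
    have h := norm_sq_eq (1 : CD (v + 1))
    simp only [left_one, right_one, norm_one' (v := v), norm_zero] at h
    nlinarith [norm_nonneg (1 : CD (v + 1))]

theorem mul_star_aux : ∀ {v : ℕ} (z : CD v),
    z * star z = ‖z‖ ^ 2 • (1 : CD v) ∧ star z * z = ‖z‖ ^ 2 • (1 : CD v)
  | 0, z => by
    have h : ∀ x : ℝ, x * x = ‖x‖ ^ 2 * 1 := fun x => by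
      rw [Real.norm_eq_abs, sq_abs, mul_one, sq]
    exact ⟨h z, h z⟩
  | v + 1, z => by
    have h₁ : ∀ a : CD v, a * star a = ‖a‖ ^ 2 • (1 : CD v) := fun a => (mul_star_aux a).1
    have h₂ : ∀ a : CD v, star a * a = ‖a‖ ^ 2 • (1 : CD v) := fun a => (mul_star_aux a).2
    constructor <;> apply ext_pair <;> simp [h₁, h₂, norm_sq_eq, add_smul]

theorem mul_star (z : CD v) : z * star z = ‖z‖ ^ 2 • (1 : CD v) := (mul_star_aux z).1

/-- The component `a` of `a + b l` as a linear map. -/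
def leftL (v : ℕ) : CD (v + 1) →ₗ[ℝ] CD v where
  toFun := left
  map_add' := left_add
  map_smul' := left_smul

/-- The real part as a real linear functional. -/
def reL : (v : ℕ) → CD v →ₗ[ℝ] ℝ
  | 0 => (LinearMap.id : ℝ →ₗ[ℝ] ℝ)
  | v + 1 => (reL v) ∘ₗ leftL v

theorem reL_succ (z : CD (v + 1)) : reL (v + 1) z = reL v (left z) := rfl

theorem add_star : ∀ {v : ℕ} (z : CD v), z + star z = (2 * reL v z) • (1 : CD v)
  | 0, z => by
    have h : ∀ x : ℝ, x + x = 2 * x * 1 := fun x => by ring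
    exact h z
  | v + 1, z => ext_pair (by simp [add_star (left z), reL_succ]) (by simp)

theorem re_eq (z : CD v) : re z = reL v z • (1 : CD v) := by
  rw [re, add_star, smul_smul]; congr 1; ring

theorem reL_one : ∀ {v : ℕ}, reL v 1 = 1
  | 0 => rfl
  | v + 1 => by rw [reL_succ, left_one, reL_one]

theorem smul_one_eq_zero {x : ℝ} (h : x • (1 : CD v) = 0) : x = 0 := by
  simpa [norm_smul, norm_one'] using congrArg norm h

theorem mem_imaginary_iff {z : CD v} : z ∈ imaginary v ↔ reL v z = 0 := by
  rw [imaginary, Set.mem_ofPred_eq, re_eq]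
  exact ⟨smul_one_eq_zero, fun h => by simp [h]⟩

theorem star_eq (z : CD v) : star z = (2 * reL v z) • (1 : CD v) - z := by
  rw [← add_star]; abel

/-! ### Planes ℝ ⊕ Mℝ as copies of ℂ -/

/-- The condition that `M` is a purely imaginary unit. -/
def IsUnitIm (M : CD v) : Prop := reL v M = 0 ∧ ‖M‖ = 1

theorem IsUnitIm.star_eq {M : CD v} (hM : IsUnitIm M) : star M = -M := by
  rw [CayleyDickson.star_eq, hM.1]; simp

theorem IsUnitIm.mul_self {M : CD v} (hM : IsUnitIm M) : M * M = -1 := by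
  have := mul_star M
  rw [hM.star_eq, hM.2] at this
  simpa [neg_eq_iff_eq_neg] using this

/-- The embedding `x + i y ↦ x + y M` of the complex numbers. -/
def phi (M : CD v) : ℂ →ₗ[ℝ] CD v where
  toFun w := w.re • (1 : CD v) + w.im • M
  map_add' a b := by simp [add_smul]; abel
  map_smul' c a := by simp [mul_smul]

theorem phi_apply (M : CD v) (w : ℂ) : phi M w = w.re • (1 : CD v) + w.im • M := rfl

theorem phi_ofReal (M : CD v) (x : ℝ) : phi M x = ofReal v x := by simp [phi_apply, ofReal]

@[simp] theorem phi_one (M : CD v) : phi M 1 = 1 := by simp [phi_apply]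

theorem phi_I (M : CD v) : phi M Complex.I = M := by simp [phi_apply]

theorem reL_phi {M : CD v} (hM : IsUnitIm M) (w : ℂ) : reL v (phi M w) = w.re := by
  simp [phi_apply, reL_one, hM.1]

/-- Only bilinearity and M² = -1 enter; associativity plays no role. -/
theorem phi_mul {M : CD v} (hM : IsUnitIm M) (a b : ℂ) : phi M (a * b) = phi M a * phi M b := by
  simp only [phi_apply, Complex.mul_re, Complex.mul_im, mul_add, add_mul, smul_mul_assoc,
    mul_smul_comm, hM.mul_self, mul_one, one_mul, sub_smul, add_smul, smul_smul, smul_neg,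
    smul_add]
  abel_nf
  simp only [mul_comm]
  abel

theorem star_phi {M : CD v} (hM : IsUnitIm M) (w : ℂ) :
    star (phi M w) = phi M (starRingEnd ℂ w) := by
  simp [phi_apply, star_smul', star_one', hM.star_eq]

/-- Transporting w · conj w = |w|² and comparing it with z z* = ‖z‖² determines the norm. -/
theorem norm_phi {M : CD v} (hM : IsUnitIm M) (w : ℂ) : ‖phi M w‖ = ‖w‖ := by
  have h := mul_star (phi M w)
  rw [star_phi hM, ← phi_mul hM, Complex.mul_conj, phi_ofReal, ofReal, ← sub_eq_zero,
    ← sub_smul] at h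
  have h := smul_one_eq_zero h
  rw [Complex.normSq_eq_norm_sq] at h
  exact ((sq_eq_sq₀ (norm_nonneg _) (norm_nonneg _)).1 (by linarith))

/-- `phi M` as a linear isometry. -/
def phiIso {M : CD v} (hM : IsUnitIm M) : ℂ →ₗᵢ[ℝ] CD v := ⟨phi M, norm_phi hM⟩

theorem phi_injective {M : CD v} (hM : IsUnitIm M) : Function.Injective (phi M) :=
  (phiIso hM).injective

theorem continuous_phi {M : CD v} (hM : IsUnitIm M) : Continuous (phi M) :=
  (phiIso hM).continuous

theorem hasSum_phi {ι : Type*} {M : CD v} (hM : IsUnitIm M) {f : ι → ℂ} {a : ℂ}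
    (h : HasSum f a) : HasSum (fun i => phi M (f i)) (phi M a) :=
  (phiIso hM).toContinuousLinearMap.hasSum h

theorem npow_phi {M : CD v} (hM : IsUnitIm M) (w : ℂ) : ∀ n, npow (phi M w) n = phi M (w ^ n)
  | 0 => by simp [npow]
  | n + 1 => by rw [npow, npow_phi hM w n, pow_succ, phi_mul hM]

theorem exp_phi {M : CD v} (hM : IsUnitIm M) (w : ℂ) : exp (phi M w) = phi M (Complex.exp w) := by
  have h := hasSum_phi hM (NormedSpace.exp_series_hasSum_exp' (𝕂 := ℝ) w)
  rw [← Complex.exp_eq_exp_ℂ] at h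
  rw [exp, ← h.tsum_eq]
  simp only [npow_phi hM, map_smul]

theorem sin_phi {M : CD v} (hM : IsUnitIm M) (w : ℂ) : sin (phi M w) = phi M (Complex.sin w) := by
  have h := hasSum_phi hM (Complex.hasSum_sin w)
  rw [sin, ← h.tsum_eq]
  congr 1; ext n
  rw [npow_phi hM, ← map_smul]
  congr 1
  rw [Complex.real_smul]; push_cast; ring

theorem inv_phi {M : CD v} (hM : IsUnitIm M) (w : ℂ) : (phi M w)⁻¹ = phi M w⁻¹ := by
  change (‖phi M w‖ ^ 2)⁻¹ • star (phi M w) = _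
  rw [norm_phi hM, star_phi hM, ← map_smul, Complex.inv_def, Complex.normSq_eq_norm_sq,
    Complex.real_smul, mul_comm]

/-- Multiplication as a continuous bilinear map. -/
def mulCLM (v : ℕ) : CD v →L[ℝ] CD v →L[ℝ] CD v :=
  LinearMap.toContinuousLinearMap
    ((LinearMap.toContinuousLinearMap (𝕜 := ℝ) (E := CD v) (F' := CD v)).toLinearMap ∘ₗ
      LinearMap.mul ℝ (CD v))

/-- Beyond the octonions the norm is not multiplicative, so the operator norm of the product serves
as the constant. -/
theorem norm_mul_le' (a b : CD v) : ‖a * b‖ ≤ ‖mulCLM v‖ * ‖a‖ * ‖b‖ :=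
  (mulCLM v).le_opNorm₂ a b

theorem isUnitIm_pair : IsUnitIm (pair (0 : CD v) 1) := by
  refine ⟨by rw [reL_succ, left_pair, map_zero], ?_⟩
  have h := norm_sq_eq (pair (0 : CD v) 1)
  rw [left_pair, right_pair, norm_zero, norm_one'] at h
  nlinarith [norm_nonneg (pair (0 : CD v) 1)]

/-- Every number lies in some plane `ℝ ⊕ N ℝ`. -/
theorem exists_phi (z : CD (v + 1)) : ∃ (N : CD (v + 1)) (w : ℂ), IsUnitIm N ∧ z = phi N w := by
  set y := z - reL (v + 1) z • (1 : CD (v + 1)) with hy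
  have hy0 : reL (v + 1) y = 0 := by simp [hy, reL_one]
  by_cases h : y = 0
  · refine ⟨pair 0 1, ⟨reL (v + 1) z, 0⟩, isUnitIm_pair, ?_⟩
    simp only [phi_apply, zero_smul, add_zero]
    exact sub_eq_zero.1 h
  · have h' := norm_ne_zero_iff.2 h
    refine ⟨‖y‖⁻¹ • y, ⟨reL (v + 1) z, ‖y‖⟩, ⟨?_, ?_⟩, ?_⟩
    · rw [map_smul, hy0, smul_zero]
    · rw [norm_smul, norm_inv, norm_norm, inv_mul_cancel₀ h']
    · rw [phi_apply, smul_smul, mul_inv_cancel₀ h', one_smul, hy]; abel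

/-! ### Hankel's formula in the logarithmic variable -/

/-- The function `exp (e^s + w s)`; its primitives are those of `e^ζ ζ^(w-1)` at `ζ = e^s`. -/
def hankelFun (w s : ℂ) : ℂ := Complex.exp (Complex.exp s + w * s)

theorem differentiable_hankelFun (w : ℂ) : Differentiable ℂ (hankelFun w) := by
  unfold hankelFun; fun_prop

theorem exists_primitive (w : ℂ) : ∃ K : ℂ → ℂ, ∀ s, HasDerivAt K (hankelFun w s) s := by
  obtain ⟨K, hK⟩ := (differentiable_hankelFun w).isExactOn_univ
  exact ⟨K, fun s => hK s (Set.mem_univ s)⟩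

theorem norm_hankelFun (w s : ℂ) : ‖hankelFun w s‖ =
    Real.exp (Real.exp s.re * Real.cos s.im + (w.re * s.re - w.im * s.im)) := by
  rw [hankelFun, Complex.norm_exp, Complex.add_re, Complex.exp_re, Complex.mul_re]

/-- This is the integration by parts that relates the exponents w and w + 1. -/
theorem hasDerivAt_hankelFun (w s : ℂ) :
    HasDerivAt (hankelFun w) (hankelFun (w + 1) s + w * hankelFun w s) s := by
  have h : HasDerivAt (hankelFun w) (Complex.exp (Complex.exp s + w * s) *
      (Complex.exp s + w * 1)) s :=
    ((Complex.hasDerivAt_exp s).add ((hasDerivAt_id s).const_mul w)).cexp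
  convert h using 1
  rw [hankelFun, hankelFun, show Complex.exp s + (w + 1) * s = Complex.exp s + w * s + s by ring,
    Complex.exp_add _ s]
  ring

/-- The part of the strip around `Im s = σ` far to the right. -/
def farStrip (σ : ℝ) : Filter ℂ :=
  comap Complex.re atTop ⊓ comap Complex.im (𝓝 σ)

/-- Within π/3 of Im s = ±π the cosine is at most -1/2, so e^(Re s) cos(Im s) beats the linear term
w s. The 6 bounds |Im s| ≤ 4π/3. -/
theorem norm_hankelFun_le (w s : ℂ) {σ : ℝ} (hσ : σ = Real.pi ∨ σ = -Real.pi) (hre : 0 ≤ s.re)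
    (him : |s.im - σ| ≤ Real.pi / 3) :
    ‖hankelFun w s‖ ≤ Real.exp (-s.re + ((|w.re| + 1) ^ 2 + |w.im| * 6)) := by
  rw [norm_hankelFun]
  apply Real.exp_le_exp.2
  have hcos : Real.cos s.im ≤ -(1 / 2) := by
    have h1 : Real.cos s.im = -Real.cos (s.im - σ) := by
      rcases hσ with rfl | rfl
      · rw [Real.cos_sub_pi]; ring
      · rw [sub_neg_eq_add, Real.cos_add_pi]; ring
    have h2 : Real.cos (Real.pi / 3) ≤ Real.cos |s.im - σ| :=
      Real.cos_le_cos_of_nonneg_of_le_pi (abs_nonneg _) (by linarith [Real.pi_pos]) him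
    rw [Real.cos_abs, Real.cos_pi_div_three] at h2
    linarith
  have hexp := Real.quadratic_le_exp_of_nonneg hre
  have him' : |s.im| ≤ 6 := by
    have h3 : |σ| = Real.pi := by
      rcases hσ with rfl | rfl
      · exact abs_of_pos Real.pi_pos
      · rw [abs_neg]; exact abs_of_pos Real.pi_pos
    have h4 : |s.im| ≤ |s.im - σ| + |σ| := by simpa using abs_add_le (s.im - σ) σ
    linarith [Real.pi_lt_d2]
  have h5 : -(w.im * s.im) ≤ |w.im| * 6 :=
    (neg_le_abs _).trans (by rw [abs_mul]; gcongr)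
  have h6 : w.re * s.re ≤ |w.re| * s.re := by gcongr; exact le_abs_self _
  have h7 : Real.exp s.re * Real.cos s.im ≤ Real.exp s.re * (-(1 / 2)) := by
    gcongr
  -- The bound e^x ≥ 1 + x + x²/2 leaves -x²/4 to absorb (|Re w| + 1) x by completing the square.
  nlinarith [sq_nonneg (s.re / 2 - (|w.re| + 1))]

theorem eventually_farStrip (σ : ℝ) :
    ∀ᶠ s in farStrip σ, 0 ≤ s.re ∧ |s.im - σ| ≤ Real.pi / 3 := by
  have h1 : ∀ᶠ s in comap Complex.re atTop, 0 ≤ s.re :=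
    tendsto_comap.eventually (eventually_ge_atTop 0)
  have h2 : ∀ᶠ s in comap Complex.im (𝓝 σ), |s.im - σ| ≤ Real.pi / 3 :=
    tendsto_comap.eventually (Metric.closedBall_mem_nhds σ (by positivity))
  exact (h1.filter_mono inf_le_left).and (h2.filter_mono inf_le_right)

theorem tendsto_hankelFun (w : ℂ) {σ : ℝ} (hσ : σ = Real.pi ∨ σ = -Real.pi) :
    Tendsto (hankelFun w) (farStrip σ) (𝓝 0) := by
  refine squeeze_zero_norm' ((eventually_farStrip σ).mono fun s hs =>
    norm_hankelFun_le w s hσ hs.1 hs.2) ?_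
  have h : Tendsto Complex.re (farStrip σ) atTop := tendsto_comap.mono_left inf_le_left
  exact Real.tendsto_exp_atBot.comp
    (tendsto_atBot_add_const_right _ _ (tendsto_neg_atTop_atBot.comp h))

theorem convex_strip (σ c : ℝ) : Convex ℝ {s : ℂ | 0 ≤ s.re ∧ |s.im - σ| ≤ c} := by
  have : {s : ℂ | 0 ≤ s.re ∧ |s.im - σ| ≤ c} =
      Complex.reLm ⁻¹' Set.Ici 0 ∩ Complex.imLm ⁻¹' Metric.closedBall σ c := by
    ext s; simp [Real.dist_eq]
  rw [this]
  exact ((convex_Ici 0).linear_preimage _).inter ((convex_closedBall σ c).linear_preimage _)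

/-- K' is bounded by C on the strip, so K at s and at its projection to the edge differ by at most C
|Im s - σ|. This covers loops that approach the cut only asymptotically. -/
theorem tendsto_farStrip_of_tendsto {w : ℂ} {K : ℂ → ℂ} (hK : ∀ s, HasDerivAt K (hankelFun w s) s)
    {σ : ℝ} (hσ : σ = Real.pi ∨ σ = -Real.pi) {A : ℂ}
    (h : Tendsto (fun x : ℝ => K (x + σ * Complex.I)) atTop (𝓝 A)) :
    Tendsto K (farStrip σ) (𝓝 A) := by
  have h1 : Tendsto (fun s : ℂ => K (s.re + σ * Complex.I)) (farStrip σ) (𝓝 A) :=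
    h.comp (tendsto_comap.mono_left inf_le_left)
  suffices h2 : Tendsto (fun s : ℂ => K s - K (s.re + σ * Complex.I)) (farStrip σ) (𝓝 0) by
    simpa using h2.add h1
  set C := Real.exp ((|w.re| + 1) ^ 2 + |w.im| * 6)
  refine squeeze_zero_norm' (a := fun s => C * |s.im - σ|) ?_ ?_
  · filter_upwards [eventually_farStrip σ] with s hs
    have hb := (convex_strip σ (Real.pi / 3)).norm_image_sub_le_of_norm_hasDerivWithin_le
      (f := K) (f' := hankelFun w) (C := C) (fun s _ => (hK s).hasDerivWithinAt)
      (fun s hs => (norm_hankelFun_le w s hσ hs.1 hs.2).trans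
        (Real.exp_le_exp.2 (by linarith [hs.1])))
      (x := s.re + σ * Complex.I) (y := s) (by simpa using ⟨hs.1, (by positivity : 0 ≤ Real.pi / 3)⟩) hs
    convert hb using 2
    have : s - (s.re + σ * Complex.I) = ((s.im - σ : ℝ) : ℂ) * Complex.I := by
      apply Complex.ext <;> simp
    rw [this, norm_mul, Complex.norm_I, mul_one, Complex.norm_real, Real.norm_eq_abs]
  · have h3 : Tendsto Complex.im (farStrip σ) (𝓝 σ) := tendsto_comap.mono_left inf_le_right
    have h4 := ((h3.sub_const σ).abs.const_mul C)
    simpa using h4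

/-- Euler's integral after the substitution `t = e^x`. -/
theorem integral_exp_neg_exp {w : ℂ} (hw : 0 < w.re) :
    Integrable (fun x : ℝ => Complex.exp (-Complex.exp x + w * x)) ∧
      ∫ x : ℝ, Complex.exp (-Complex.exp x + w * x) = Complex.Gamma w := by
  have himg : Real.exp '' Set.univ = Set.Ioi 0 := by rw [Set.image_univ, Real.range_exp]
  have hd : ∀ x ∈ Set.univ, HasDerivWithinAt Real.exp (Real.exp x) Set.univ x :=
    fun x _ => (Real.hasDerivAt_exp x).hasDerivWithinAt
  have hinj : Set.InjOn Real.exp Set.univ := Real.exp_injective.injOn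
  have heq : (fun x : ℝ => |Real.exp x| •
      (((-(Real.exp x)).exp : ℂ) * ((Real.exp x : ℝ) : ℂ) ^ (w - 1))) =
      fun x : ℝ => Complex.exp (-Complex.exp x + w * x) := by
    ext x
    rw [abs_of_pos (Real.exp_pos x), Complex.real_smul, Complex.cpow_def_of_ne_zero
      (Complex.ofReal_ne_zero.2 (Real.exp_pos x).ne'), ← Complex.ofReal_log (Real.exp_pos x).le,
      Real.log_exp]
    push_cast
    rw [← Complex.exp_add, ← Complex.exp_add]
    congr 1; ring
  have h1 := Complex.GammaIntegral_convergent hw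
  rw [← himg, integrableOn_image_iff_integrableOn_abs_deriv_smul MeasurableSet.univ hd hinj,
    integrableOn_univ] at h1
  refine ⟨by rw [← heq]; exact_mod_cast h1, ?_⟩
  rw [Complex.Gamma_eq_integral hw, Complex.GammaIntegral, ← himg,
    integral_image_eq_integral_abs_deriv_smul MeasurableSet.univ hd hinj, setIntegral_univ, ← heq]

theorem hankelFun_edge (w : ℂ) {σ : ℝ} (hσ : σ = Real.pi ∨ σ = -Real.pi) (x : ℝ) :
    hankelFun w (x + σ * Complex.I) =
      Complex.exp (w * (σ * Complex.I)) * Complex.exp (-Complex.exp x + w * x) := by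
  have h : Complex.exp (σ * Complex.I) = -1 := by
    rcases hσ with rfl | rfl
    · exact Complex.exp_pi_mul_I
    · rw [Complex.ofReal_neg, neg_mul, Complex.exp_neg, Complex.exp_pi_mul_I]; norm_num
  rw [hankelFun, Complex.exp_add (x : ℂ), h, ← Complex.exp_add]
  congr 1; ring

/-- A - a is the integral of K' along the whole edge, where e^s = -e^x turns it into a multiple of
Euler's integral. -/
theorem exists_edge_limits {w : ℂ} (hw : 0 < w.re) {K : ℂ → ℂ}
    (hK : ∀ s, HasDerivAt K (hankelFun w s) s) {σ : ℝ} (hσ : σ = Real.pi ∨ σ = -Real.pi) :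
    ∃ A a : ℂ, Tendsto K (farStrip σ) (𝓝 A) ∧
      Tendsto (fun x : ℝ => K (x + σ * Complex.I)) atBot (𝓝 a) ∧
      A - a = Complex.exp (w * (σ * Complex.I)) * Complex.Gamma w := by
  obtain ⟨hi, hI⟩ := integral_exp_neg_exp hw
  have hd : ∀ x : ℝ, HasDerivAt (fun x : ℝ => K (x + σ * Complex.I))
      (hankelFun w (x + σ * Complex.I)) x := fun x => by
    have := HasDerivAt.comp_add_const (x : ℂ) (σ * Complex.I) (hK (x + σ * Complex.I))
    exact this.comp_ofReal
  have hint : Integrable (fun x : ℝ => hankelFun w (x + σ * Complex.I)) := by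
    simp_rw [hankelFun_edge w hσ]
    exact hi.const_mul _
  have h1 := tendsto_limUnder_of_hasDerivAt_of_integrableOn_Ioi (a := 0) (fun x _ => hd x)
    hint.integrableOn
  have h2 := tendsto_limUnder_of_hasDerivAt_of_integrableOn_Iic (a := 0) (fun x _ => hd x)
    hint.integrableOn
  refine ⟨_, _, tendsto_farStrip_of_tendsto hK hσ h1, h2, ?_⟩
  rw [← integral_of_hasDerivAt_of_tendsto hd hint h2 h1]
  simp_rw [hankelFun_edge w hσ]
  rw [integral_const_mul, hI]

/-- The vertical segment between the edges is a small circle around ζ = 0; it has length 2π and K' =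
O(e^(x Re w)) on it. -/
theorem tendsto_edge_sub {w : ℂ} (hw : 0 < w.re) {K : ℂ → ℂ}
    (hK : ∀ s, HasDerivAt K (hankelFun w s) s) :
    Tendsto (fun x : ℝ => K (x + (Real.pi : ℝ) * Complex.I) -
      K (x + ((-Real.pi : ℝ) : ℂ) * Complex.I)) atBot (𝓝 0) := by
  refine squeeze_zero_norm' (a := fun x => Real.exp (1 + w.re * x + |w.im| * Real.pi) *
    (2 * Real.pi)) ?_ ?_
  · filter_upwards [eventually_le_atBot 0] with x hx
    have hconv : Convex ℝ {s : ℂ | s.re = x ∧ |s.im| ≤ Real.pi} := by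
      have : {s : ℂ | s.re = x ∧ |s.im| ≤ Real.pi} =
          Complex.reLm ⁻¹' {x} ∩ Complex.imLm ⁻¹' Metric.closedBall 0 Real.pi := by
        ext s; simp
      rw [this]
      exact ((convex_singleton x).linear_preimage _).inter
        ((convex_closedBall _ _).linear_preimage _)
    have hb := hconv.norm_image_sub_le_of_norm_hasDerivWithin_le
      (f := K) (f' := hankelFun w) (C := Real.exp (1 + w.re * x + |w.im| * Real.pi))
      (fun s _ => (hK s).hasDerivWithinAt) (fun s hs => ?_)
      (x := x + ((-Real.pi : ℝ) : ℂ) * Complex.I) (y := x + (Real.pi : ℝ) * Complex.I)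
      (by simp [abs_of_pos Real.pi_pos]) (by simp [abs_of_pos Real.pi_pos])
    · refine hb.trans (le_of_eq ?_)
      congr 1
      have : (x + (Real.pi : ℝ) * Complex.I) - (x + ((-Real.pi : ℝ) : ℂ) * Complex.I) =
          ((2 * Real.pi : ℝ) : ℂ) * Complex.I := by push_cast; ring
      rw [this, norm_mul, Complex.norm_I, mul_one, Complex.norm_real, Real.norm_eq_abs,
        abs_of_pos (by positivity)]
    · rw [norm_hankelFun, hs.1]
      apply Real.exp_le_exp.2
      have h1 : Real.exp x * Real.cos s.im ≤ 1 :=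
        (mul_le_of_le_one_right (Real.exp_pos x).le (Real.cos_le_one _)).trans
          (Real.exp_le_one_iff.2 hx)
      have h2 : -(w.im * s.im) ≤ |w.im| * Real.pi :=
        (neg_le_abs _).trans (by rw [abs_mul]; gcongr; exact hs.2)
      linarith
  · have h1 : Tendsto (fun x => 1 + w.re * x + |w.im| * Real.pi) atBot atBot :=
      tendsto_atBot_add_const_right _ _
        (tendsto_atBot_add_const_left _ _ (tendsto_id.const_mul_atBot hw))
    simpa using (Real.tendsto_exp_atBot.comp h1).mul_const (2 * Real.pi)

/-- Hankel's formula, in terms of a primitive of the integrand. -/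
theorem hankel_formula_of_primitive (n : ℕ) : ∀ {w : ℂ}, (∀ m : ℤ, w ≠ m) → -(n : ℝ) < w.re →
    ∀ {K : ℂ → ℂ}, (∀ s, HasDerivAt K (hankelFun w s) s) →
    ∃ A B : ℂ, Tendsto K (farStrip Real.pi) (𝓝 A) ∧ Tendsto K (farStrip (-Real.pi)) (𝓝 B) ∧
      A - B = 2 * Complex.I * Complex.sin (Real.pi * w) * Complex.Gamma w := by
  induction n with
  | zero =>
    intro w _ hre K hK
    have hre : 0 < w.re := by simpa using hre
    obtain ⟨A, a, hA, ha, hAa⟩ := exists_edge_limits hre hK (Or.inl rfl)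
    obtain ⟨B, b, hB, hb, hBb⟩ := exists_edge_limits hre hK (Or.inr rfl)
    have hab : a - b = 0 := tendsto_nhds_unique (ha.sub hb) (tendsto_edge_sub hre hK)
    refine ⟨A, B, hA, hB, ?_⟩
    have h1 : A - B = (A - a) - (B - b) + (a - b) := by ring
    rw [h1, hAa, hBb, hab, Complex.sin]
    have h2 : w * ((Real.pi : ℝ) * Complex.I) = Real.pi * w * Complex.I := by ring
    have h3 : w * (((-Real.pi : ℝ) : ℂ) * Complex.I) = -(Real.pi * w) * Complex.I := by
      push_cast; ring
    rw [h2, h3]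
    linear_combination (Complex.exp (Real.pi * w * Complex.I) -
      Complex.exp (-(Real.pi * w) * Complex.I)) * Complex.Gamma w * Complex.I_sq
  | succ n ih =>
    intro w hw hre K hK
    have hw0 : w ≠ 0 := by simpa using hw 0
    obtain ⟨K', hK'⟩ := exists_primitive (w + 1)
    obtain ⟨A, B, hA, hB, hAB⟩ := ih (w := w + 1)
      (fun m h => hw (m - 1) (by push_cast; rw [← h]; ring))
      (by push_cast at hre; simp; linarith) hK'
    -- By parts, the primitives for w and w + 1 are linked up to a constant. The boundary term
    -- `hankelFun w` vanishes at both ends, and Γ(w+1) = wΓ(w), sin(πw + π) = -sin(πw) finish.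
    have hd : ∀ s, HasDerivAt (fun s => hankelFun w s - K' s - w * K s) 0 s := fun s => by
      exact (((hasDerivAt_hankelFun w s).sub (hK' s)).sub ((hK s).const_mul w)).congr_deriv
        (by ring)
    have hc : ∀ s, hankelFun w s - K' s - w * K s = hankelFun w 0 - K' 0 - w * K 0 := fun s =>
      is_const_of_deriv_eq_zero (fun s => (hd s).differentiableAt) (fun s => (hd s).deriv) s 0
    generalize hankelFun w 0 - K' 0 - w * K 0 = c at hc
    have hKe : K = fun s => (hankelFun w s - K' s - c) / w := by
      ext s; rw [← hc s]; field_simp; ring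
    refine ⟨(0 - A - c) / w, (0 - B - c) / w, ?_, ?_, ?_⟩
    · rw [hKe]
      exact (((tendsto_hankelFun w (Or.inl rfl)).sub hA).sub_const c).div_const w
    · rw [hKe]
      exact (((tendsto_hankelFun w (Or.inr rfl)).sub hB).sub_const c).div_const w
    · rw [Complex.Gamma_add_one w hw0, mul_add, mul_one, Complex.sin_add_pi] at hAB
      rw [← sub_div, div_eq_iff hw0]
      linear_combination -hAB

/-! ### Line integrals along the loop -/

/-- A local Lipschitz bound for the logarithm: it controls increments of the lift by those of the
path, whose variation is the one assumed finite. -/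
theorem norm_le_norm_exp_sub {R : ℝ} {x y : ℂ} (hx : ‖x‖ ≤ R) (hxy : ‖y - x‖ ≤ 1 / 2) :
    ‖y - x‖ ≤ 2 * Real.exp R * ‖Complex.exp y - Complex.exp x‖ := by
  have h1 := Complex.norm_exp_sub_one_sub_id_le (x := y - x) (by linarith)
  have h2 : ‖y - x‖ ≤ 2 * ‖Complex.exp (y - x) - 1‖ := by
    have h3 : ‖y - x‖ ≤ ‖Complex.exp (y - x) - 1‖ + ‖Complex.exp (y - x) - 1 - (y - x)‖ := by
      simpa using norm_sub_le (Complex.exp (y - x) - 1) (Complex.exp (y - x) - 1 - (y - x))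
    nlinarith [norm_nonneg (y - x)]
  have h4 : Complex.exp (y - x) - 1 = Complex.exp (-x) * (Complex.exp y - Complex.exp x) := by
    rw [mul_sub, ← Complex.exp_add, ← Complex.exp_add, neg_add_cancel, Complex.exp_zero,
      neg_add_eq_sub]
  have h5 : ‖Complex.exp (-x)‖ ≤ Real.exp R := by
    rw [Complex.norm_exp]
    exact Real.exp_le_exp.2 (((Complex.re_le_norm _).trans (norm_neg x).le).trans hx)
  rw [h4, norm_mul] at h2
  have := mul_le_mul_of_nonneg_right h5 (norm_nonneg (Complex.exp y - Complex.exp x))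
  linarith

/-- The lift of the loop to the logarithmic covering of the punctured plane. -/
def HankelLoop.lift (ψ : HankelLoop M) (t : ℝ) : ℂ :=
  Real.log ‖ψ.path t‖ + ψ.arg t * Complex.I

theorem HankelLoop.continuous_lift (ψ : HankelLoop M) : Continuous ψ.lift := by
  have h : Continuous fun t => Real.log ‖ψ.path t‖ :=
    ψ.continuous_path.norm.log fun t => norm_ne_zero_iff.2 (ψ.path_ne_zero t)
  have := ψ.continuous_arg
  unfold HankelLoop.lift
  fun_prop

theorem HankelLoop.Ln_eq (ψ : HankelLoop M) (t : ℝ) : ψ.Ln t = phi M (ψ.lift t) := by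
  simp [HankelLoop.Ln, HankelLoop.lift, phi_apply, ofReal]

theorem HankelLoop.path_eq_phi (hM : IsUnitIm M) (ψ : HankelLoop M) (t : ℝ) :
    ψ.path t = phi M (Complex.exp (ψ.lift t)) := by
  have h1 : ψ.arg t • M = phi M (ψ.arg t * Complex.I) := by simp [phi_apply]
  rw [ψ.path_eq t, h1, exp_phi hM, ← map_smul, HankelLoop.lift, Complex.exp_add,
    ← Complex.ofReal_exp, Real.exp_log (norm_pos_iff.2 (ψ.path_ne_zero t)), Complex.real_smul]

theorem HankelLoop.tendsto_lift {ψ : HankelLoop M} {l : Filter ℝ} {σ : ℝ}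
    (h1 : Tendsto (fun t => ‖ψ.path t‖) l atTop) (h2 : Tendsto ψ.arg l (𝓝 σ)) :
    Tendsto ψ.lift l (farStrip σ) := by
  refine tendsto_inf.2 ⟨tendsto_comap_iff.2 ?_, tendsto_comap_iff.2 ?_⟩
  · have : Complex.re ∘ ψ.lift = fun t => Real.log ‖ψ.path t‖ := by
      ext t; simp [HankelLoop.lift]
    rw [this]
    exact Real.tendsto_log_atTop.comp h1
  · have : Complex.im ∘ ψ.lift = ψ.arg := by
      ext t; simp [HankelLoop.lift]
    rw [this]
    exact h2

/-- A line integral of a function with a primitive on the logarithmic covering. -/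
theorem HankelLoop.hasLineIntegral (hM : IsUnitIm M) (ψ : HankelLoop M) {g K : ℂ → ℂ}
    (hg : Continuous g) (hK : ∀ s, HasDerivAt K (g s * Complex.exp s) s) {a b : ℝ} :
    HasLineIntegral (fun t => phi M (g (ψ.lift t))) ψ.path a b
      (phi M (K (ψ.lift b) - K (ψ.lift a))) := by
  intro ε hε
  obtain ⟨R, hR⟩ := (isCompact_Icc (a := a) (b := b)).exists_bound_of_continuousOn
    ψ.continuous_lift.continuousOn
  set V := (eVariationOn ψ.path (Set.univ ∩ Set.Icc a b)).toReal with hV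
  have hV0 : 0 ≤ V := ENNReal.toReal_nonneg
  -- One factor e^R bounds |e^t|, the factor 2e^R is the Lipschitz constant of the logarithm; V + 1
  -- avoids division by zero and makes the final inequality strict.
  set ε' := ε / (2 * Real.exp R * Real.exp R * (V + 1)) with hε'
  have hε'0 : 0 < ε' := by positivity
  have hug := (isCompact_closedBall (0 : ℂ) R).uniformContinuousOn_of_continuous hg.continuousOn
  obtain ⟨ρ, hρ, hgρ⟩ := Metric.uniformContinuousOn_iff.1 hug ε' hε'0
  have huL := (isCompact_Icc (a := a) (b := b)).uniformContinuousOn_of_continuous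
    ψ.continuous_lift.continuousOn
  -- With 1/4 on each side of the tag, neighbouring lifts stay within the 1/2 that
  -- `norm_le_norm_exp_sub` requires.
  obtain ⟨δ, hδ, hLδ⟩ := Metric.uniformContinuousOn_iff.1 huL (min ρ (1 / 4))
    (lt_min hρ (by norm_num))
  refine ⟨δ, hδ, fun n s τ hs0 hsn hst => ?_⟩
  have hmono : MonotoneOn s (Set.Iic n) := by
    intro i _ j hj hij
    induction j, hij using Nat.le_induction with
    | base => exact le_rfl
    | succ k hk ih =>
      have hk' : k < n := hj
      exact (ih hk'.le).trans ((hst k hk').1.trans (hst k hk').2.1)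
  have hmem : ∀ i ≤ n, s i ∈ Set.Icc a b := fun i hi =>
    ⟨hs0 ▸ hmono (Nat.zero_le n) hi (Nat.zero_le i), hsn ▸ hmono hi (Set.mem_Iic.2 le_rfl) hi⟩
  have hstep : ∀ j ∈ Finset.range n,
      ‖g (ψ.lift (τ j)) * (Complex.exp (ψ.lift (s (j + 1))) - Complex.exp (ψ.lift (s j))) -
        (K (ψ.lift (s (j + 1))) - K (ψ.lift (s j)))‖ ≤
      ε' * (2 * Real.exp R * Real.exp R) * ‖ψ.path (s (j + 1)) - ψ.path (s j)‖ := by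
    intro j hj
    have hj := Finset.mem_range.1 hj
    obtain ⟨h1, h2, h3⟩ := hst j hj
    have m1 := hmem j hj.le
    have m2 := hmem (j + 1) hj
    have mτ : τ j ∈ Set.Icc a b := ⟨m1.1.trans h1, h2.trans m2.2⟩
    set u := ψ.lift (τ j)
    set x := ψ.lift (s j)
    set y := ψ.lift (s (j + 1))
    have dx : dist x u < min ρ (1 / 4) := hLδ _ m1 _ mτ (by
      rw [Real.dist_eq, abs_lt]; constructor <;> linarith)
    have dy : dist y u < min ρ (1 / 4) := hLδ _ m2 _ mτ (by
      rw [Real.dist_eq, abs_lt]; constructor <;> linarith)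
    have hxy : ‖y - x‖ ≤ 1 / 2 := by
      rw [← dist_eq_norm]
      have := dist_triangle_right y x u
      have := min_le_right ρ (1 / 4)
      linarith
    -- Mean value inequality for g(u) e^t - K(t), whose derivative (g(u) - g(t)) e^t is small near
    -- the tag u; the ball of radius R keeps t where g is uniformly continuous.
    have hb := ((convex_ball u (min ρ (1 / 4))).inter
        (convex_closedBall (0 : ℂ) R)).norm_image_sub_le_of_norm_hasDerivWithin_le
      (f := fun t => g u * Complex.exp t - K t) (f' := fun t => (g u - g t) * Complex.exp t)
      (C := ε' * Real.exp R)
      (fun t _ => ((((Complex.hasDerivAt_exp t).const_mul (g u)).sub (hK t)).congr_deriv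
        (by ring)).hasDerivWithinAt)
      (fun t ht => ?_) (x := x) (y := y) ⟨dx, by simpa using hR _ m1⟩ ⟨dy, by simpa using hR _ m2⟩
    · have e1 : g u * Complex.exp y - K y - (g u * Complex.exp x - K x) =
          g u * (Complex.exp y - Complex.exp x) - (K y - K x) := by ring
      rw [e1] at hb
      refine hb.trans ?_
      have h4 := norm_le_norm_exp_sub (hR _ m1) hxy
      rw [ψ.path_eq_phi hM, ψ.path_eq_phi hM, ← map_sub, norm_phi hM]
      calc ε' * Real.exp R * ‖y - x‖
          ≤ ε' * Real.exp R * (2 * Real.exp R * ‖Complex.exp y - Complex.exp x‖) := by gcongr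
        _ = _ := by ring
    · rw [norm_mul]
      have h5 : ‖g u - g t‖ ≤ ε' := by
        rw [← dist_eq_norm]
        refine (hgρ u (by simpa using hR _ mτ) t ht.2 ?_).le
        rw [dist_comm]
        exact lt_of_lt_of_le ht.1 (min_le_left _ _)
      have h6 : ‖Complex.exp t‖ ≤ Real.exp R := by
        rw [Complex.norm_exp]
        exact Real.exp_le_exp.2 ((Complex.re_le_norm _).trans (by simpa using ht.2))
      gcongr
  have hvar : ∑ j ∈ Finset.range n, ‖ψ.path (s (j + 1)) - ψ.path (s j)‖ ≤ V := by
    have h1 := eVariationOn.sum_le_of_monotoneOn_Iic (f := ψ.path)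
      (s := Set.univ ∩ Set.Icc a b) hmono (fun i hi => ⟨Set.mem_univ _, hmem i hi⟩)
    have hfin : eVariationOn ψ.path (Set.univ ∩ Set.Icc a b) ≠ ⊤ :=
      ψ.rectifiable a b (Set.mem_univ _) (Set.mem_univ _)
    have h2 := ENNReal.toReal_mono hfin h1
    rw [ENNReal.toReal_sum (fun _ _ => edist_ne_top _ _)] at h2
    simpa [edist_dist, dist_eq_norm, hV] using h2
  have hsum : (∑ j ∈ Finset.range n, phi M (g (ψ.lift (τ j))) *
      (ψ.path (s (j + 1)) - ψ.path (s j))) - phi M (K (ψ.lift b) - K (ψ.lift a)) =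
      phi M (∑ j ∈ Finset.range n, (g (ψ.lift (τ j)) *
        (Complex.exp (ψ.lift (s (j + 1))) - Complex.exp (ψ.lift (s j))) -
        (K (ψ.lift (s (j + 1))) - K (ψ.lift (s j))))) := by
    rw [Finset.sum_sub_distrib, Finset.sum_range_sub (fun j => K (ψ.lift (s j))), hs0, hsn]
    simp only [ψ.path_eq_phi hM, phi_mul hM, map_sub, map_sum]
  rw [hsum, norm_phi hM]
  calc _ ≤ ∑ j ∈ Finset.range n,
        ε' * (2 * Real.exp R * Real.exp R) * ‖ψ.path (s (j + 1)) - ψ.path (s j)‖ :=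
        norm_sum_le_of_le _ hstep
    _ ≤ ε' * (2 * Real.exp R * Real.exp R) * V := by rw [← Finset.mul_sum]; gcongr
    _ < ε' * (2 * Real.exp R * Real.exp R) * (V + 1) := by gcongr; linarith
    _ = ε := by rw [hε']; field_simp

/-- Hankel's integral on the plane `ℝ ⊕ M ℝ`. -/
theorem HankelLoop.hasImproperLineIntegral (hM : IsUnitIm M) (ψ : HankelLoop M) {w : ℂ}
    (hw : ∀ m : ℤ, w ≠ m) :
    HasImproperLineIntegral (fun t => exp (ψ.path t) * ψ.cpow (phi M w - 1) t) ψ.path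
      (phi M (2 * Complex.I * Complex.sin (Real.pi * w) * Complex.Gamma w)) := by
  obtain ⟨K, hK⟩ := exists_primitive w
  obtain ⟨n, hn⟩ := exists_nat_gt (-w.re)
  obtain ⟨A, B, hA, hB, hAB⟩ := hankel_formula_of_primitive n hw (by linarith) hK
  have hf : (fun t => exp (ψ.path t) * ψ.cpow (phi M w - 1) t) =
      fun t => phi M (hankelFun (w - 1) (ψ.lift t)) := by
    ext t
    have h1 : phi M w - 1 = phi M (w - 1) := by rw [map_sub, phi_one]
    rw [HankelLoop.cpow, h1, ψ.path_eq_phi hM, ψ.Ln_eq, ← phi_mul hM, exp_phi hM, exp_phi hM,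
      ← phi_mul hM, hankelFun, Complex.exp_add]
  rw [hf]
  refine ⟨fun a b => phi M (K (ψ.lift b) - K (ψ.lift a)), fun a b _ =>
    ψ.hasLineIntegral hM (differentiable_hankelFun (w - 1)).continuous fun s => ?_, ?_⟩
  -- The factor e^s is dζ/ds and raises the exponent from w - 1 to w.
  · have h2 : hankelFun (w - 1) s * Complex.exp s = hankelFun w s := by
      rw [hankelFun, hankelFun, ← Complex.exp_add]; congr 1; ring
    rw [h2]; exact hK s
  · rw [← hAB]
    have h3 := hA.comp ((HankelLoop.tendsto_lift ψ.norm_end ψ.arg_end).comp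
      (tendsto_snd (f := (atBot : Filter ℝ))))
    have h4 := hB.comp ((HankelLoop.tendsto_lift ψ.norm_start ψ.arg_start).comp
      (tendsto_fst (g := (atTop : Filter ℝ))))
    exact (continuous_phi hM).continuousAt.tendsto.comp (h3.sub h4)

/-! ### Uniqueness of the Gamma function on planes -/

/-- The number of occurrences of the variable in a word. -/
def Word.degree : Word v → ℕ
  | .var => 1
  | .const _ => 0
  | .mul p q => p.degree + q.degree

theorem Word.eval_smul (t : ℝ) (h : CD v) : ∀ w : Word v,
    w.eval (t • h) = t ^ w.degree • w.eval h
  | .var => by simp [Word.eval, Word.degree]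
  | .const a => by simp [Word.eval, Word.degree]
  | .mul p q => by
    simp only [Word.eval, Word.degree, Word.eval_smul t h p, Word.eval_smul t h q, pow_add,
      smul_mul_assoc, mul_smul_comm, smul_smul, mul_comm]

/-- A holomorphic function is real analytic on every real line. -/
theorem HolomorphicAt.analyticAt_line {f : CD v → CD v} {z₀ : CD v} (hf : HolomorphicAt f z₀)
    (u : CD v) : AnalyticAt ℝ (fun t : ℝ => f (z₀ + t • u)) 0 := by
  obtain ⟨r, hr, ι, w, b, hb, hwb, hsum⟩ := hf
  obtain ⟨ρ, hρ, hρr⟩ : ∃ ρ : ℝ, 0 < ρ ∧ ‖ρ • u‖ < r := by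
    refine ⟨r / (‖u‖ + 1), by positivity, ?_⟩
    rw [norm_smul, Real.norm_of_nonneg (by positivity), div_mul_eq_mul_div,
      div_lt_iff₀ (by positivity)]
    nlinarith [norm_nonneg u]
  -- Words are homogeneous under real scaling: from ρu to tu each is multiplied by (t/ρ) to its
  -- degree. Collecting words of equal degree gives a power series in t.
  set A : ι → CD v := fun k => (w k).eval (ρ • u)
  have hA : ∀ k, ‖A k‖ ≤ b k := fun k => hwb k _ hρr
  have hAs : Summable A := Summable.of_norm_bounded hb hA
  let d : ι → ℕ := fun k => (w k).degree
  let p : FormalMultilinearSeries ℝ ℝ (CD v) := fun n =>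
    ContinuousMultilinearMap.mkPiRing ℝ (Fin n)
      ((ρ⁻¹) ^ n • ∑' k : {k // d k = n}, A k)
  refine ⟨p, hasFPowerSeriesAt_iff.2 ?_⟩
  filter_upwards [Metric.ball_mem_nhds (0 : ℝ) hρ] with t ht
  have ht : |t| < ρ := by simpa using ht
  have htu : ‖t • u‖ < r := by
    refine lt_of_le_of_lt ?_ hρr
    rw [norm_smul, norm_smul, Real.norm_eq_abs, Real.norm_of_nonneg hρ.le]
    gcongr
  have h1 := hsum _ htu
  have h2 : ∀ k, (w k).eval (t • u) = (t * ρ⁻¹) ^ d k • A k := fun k => by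
    have : t • u = (t * ρ⁻¹) • ρ • u := by
      rw [smul_smul, mul_assoc, inv_mul_cancel₀ hρ.ne', mul_one]
    rw [this, Word.eval_smul]
  rw [← (Equiv.sigmaFiberEquiv d).hasSum_iff] at h1
  have h3 := h1.sigma (g := fun n => t ^ n • p.coeff n) (fun n => ?_)
  · simpa using h3
  · have h4 : Summable fun k : {k // d k = n} => A k := hAs.subtype _
    have h5 := h4.hasSum.const_smul ((t * ρ⁻¹) ^ n)
    have h6 : t ^ n • p.coeff n = (t * ρ⁻¹) ^ n • ∑' k : {k // d k = n}, A k := by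
      simp only [FormalMultilinearSeries.coeff, p, ContinuousMultilinearMap.mkPiRing_apply]
      simp [smul_smul, mul_pow]
    rw [h6]
    refine h5.congr_fun fun k => ?_
    simp only [Function.comp_apply, Equiv.sigmaFiberEquiv_apply, h2, k.2]

theorem gammaIntegrand_phi (hM : IsUnitIm M) (w : ℂ) {t : ℝ} (ht : 0 < t) :
    gammaIntegrand (phi M w) t = phi M ((-t).exp * (t : ℂ) ^ (w - 1)) := by
  have h1 : phi M w - 1 = phi M (w - 1) := by rw [map_sub, phi_one]
  rw [gammaIntegrand, h1, ← map_smul, exp_phi hM, ← map_smul, Complex.real_smul,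
    Complex.cpow_def_of_ne_zero (Complex.ofReal_ne_zero.2 ht.ne'), ← Complex.ofReal_log ht.le,
    Complex.real_smul]

theorem integrableOn_gammaIntegrand (hM : IsUnitIm M) {w : ℂ} (hw : 0 < w.re) :
    IntegrableOn (gammaIntegrand (phi M w)) (Set.Ioi 0) :=
  IntegrableOn.congr_fun
    ((phiIso hM).toContinuousLinearMap.integrable_comp (Complex.GammaIntegral_convergent hw))
    (fun _ ht => (gammaIntegrand_phi hM w ht).symm) measurableSet_Ioi

theorem integral_gammaIntegrand (hM : IsUnitIm M) {w : ℂ} (hw : 0 < w.re) :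
    ∫ t in Set.Ioi (0 : ℝ), gammaIntegrand (phi M w) t = phi M (Complex.Gamma w) := by
  rw [Complex.Gamma_eq_integral hw, Complex.GammaIntegral,
    setIntegral_congr_fun measurableSet_Ioi fun t ht => gammaIntegrand_phi hM w ht]
  exact (phiIso hM).integral_comp_comm _

/-- On (0, 1) the integrand has norm at least e⁻¹ t^(Re w - 1). Hence Euler's integral constrains a
Gamma function only where Re w > 0. -/
theorem re_pos_of_integrableOn (hM : IsUnitIm M) {w : ℂ}
    (h : IntegrableOn (gammaIntegrand (phi M w)) (Set.Ioi 0)) : 0 < w.re := by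
  have h1 : IntegrableOn (fun t : ℝ => t ^ (w.re - 1)) (Set.Ioo 0 1) := by
    have h2 : IntegrableOn (fun t => Real.exp 1 * ‖gammaIntegrand (phi M w) t‖) (Set.Ioo 0 1) :=
      (h.mono_set Set.Ioo_subset_Ioi_self).norm.const_mul _
    refine Integrable.mono h2 ?_ ?_
    · exact (ContinuousOn.rpow_const continuousOn_id
        fun t ht => Or.inl ht.1.ne').aestronglyMeasurable measurableSet_Ioo
    · refine (ae_restrict_iff' measurableSet_Ioo).2 (Eventually.of_forall fun t ht => ?_)
      rw [gammaIntegrand_phi hM w ht.1, norm_phi hM, norm_mul (Complex.ofReal _),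
        Complex.norm_cpow_eq_rpow_re_of_pos ht.1, Complex.norm_real, norm_mul, norm_mul,
        Real.norm_of_nonneg (Real.rpow_nonneg ht.1.le _), Real.norm_of_nonneg (Real.exp_pos _).le,
        Real.norm_of_nonneg (Real.exp_pos _).le,
        Real.norm_of_nonneg (Real.rpow_nonneg ht.1.le _),
        Real.norm_of_nonneg (Real.exp_pos (-t)).le, ← mul_assoc, ← Real.exp_add, Complex.sub_re, Complex.one_re]
      exact le_mul_of_one_le_left (Real.rpow_nonneg ht.1.le _)
        (Real.one_le_exp (by linarith [ht.2]))
  have := (intervalIntegral.integrableOn_Ioo_rpow_iff one_pos).1 h1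
  linarith

/-- 1/Γ is entire and does not vanish away from the poles. -/
theorem analyticAt_Gamma {w : ℂ} (hw : ∀ m : ℕ, w ≠ -m) : AnalyticAt ℂ Complex.Gamma w := by
  have h1 := (Complex.differentiable_one_div_Gamma.analyticAt w).inv
    (inv_ne_zero (Complex.Gamma_ne_zero hw))
  simpa [Pi.inv_def] using! h1

theorem analyticAt_phi_Gamma_line (hM : IsUnitIm M) {w : ℂ} (e : ℂ) (t₀ : ℝ)
    (hw : ∀ m : ℕ, w + t₀ * e ≠ -m) :
    AnalyticAt ℝ (fun t : ℝ => phi M (Complex.Gamma (w + t * e))) t₀ := by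
  have h1 := (analyticAt_Gamma hw).restrictScalars (𝕜 := ℝ)
  have h2 : AnalyticAt ℝ (fun t : ℝ => w + (t : ℂ) * e) t₀ :=
    analyticAt_const.add ((Complex.ofRealCLM.analyticAt t₀).mul analyticAt_const)
  exact ((phiIso hM).toContinuousLinearMap.analyticAt _).comp (h1.comp_of_eq h2 rfl)

theorem analyticAt_line (M : CD v) {G : CD v → CD v} {w : ℂ} (e : ℂ) (t₀ : ℝ)
    (hG : HolomorphicAt G (phi M (w + t₀ * e))) :
    AnalyticAt ℝ (fun t : ℝ => G (phi M (w + t * e))) t₀ := by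
  have h1 := hG.analyticAt_line (phi M e)
  have h2 : AnalyticAt ℝ (fun t : ℝ => t - t₀) t₀ := analyticAt_id.sub analyticAt_const
  have h3 := h1.comp_of_eq h2 (sub_self t₀)
  refine h3.congr (Eventually.of_forall fun t => ?_)
  simp only [Function.comp_apply]
  rw [← map_smul, ← map_add]
  congr 2
  rw [Complex.real_smul]; push_cast; ring

theorem phi_ne_pole (hM : IsUnitIm M) {w : ℂ} (hw : ∀ m : ℕ, w ≠ -m) (m : ℕ) :
    phi M w ≠ ofReal v (-(m : ℝ)) := by
  rw [← phi_ofReal M]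
  intro h
  exact hw m (by simpa using phi_injective hM h)

/-- On every plane `ℝ ⊕ M ℝ` the Gamma function of `A_v` is the complex one. -/
theorem IsGammaFunction.apply_phi (hM : IsUnitIm M) {G : CD v → CD v} (hG : IsGammaFunction G)
    {w : ℂ} (hw : ∀ m : ℕ, w ≠ -m) : G (phi M w) = phi M (Complex.Gamma w) := by
  have hpos : ∀ w : ℂ, 0 < w.re → G (phi M w) = phi M (Complex.Gamma w) := fun w hw => by
    rw [hG.1 _ (integrableOn_gammaIntegrand hM hw), integral_gammaIntegrand hM hw]
  have hhol : ∀ w : ℂ, (∀ m : ℕ, w ≠ -m) → HolomorphicAt G (phi M w) := fun w hw =>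
    hG.2 _ (phi_ne_pole hM hw)
  have him : ∀ w : ℂ, w.im ≠ 0 → G (phi M w) = phi M (Complex.Gamma w) := fun w hw => by
    have hne : ∀ (t : ℝ) (m : ℕ), w + t * 1 ≠ -m := fun t m h => hw (by
      simpa using congrArg Complex.im h)
    have h1 : AnalyticOnNhd ℝ (fun t : ℝ => G (phi M (w + t * 1))) Set.univ := fun t _ =>
      analyticAt_line M 1 t (hhol _ (hne t))
    have h2 : AnalyticOnNhd ℝ (fun t : ℝ => phi M (Complex.Gamma (w + t * 1))) Set.univ :=
      fun t _ => analyticAt_phi_Gamma_line hM 1 t (hne t)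
    -- Identity theorem on the horizontal line through w, which avoids the poles; the base point has
    -- real part 1, where Euler's integral applies.
    have h3 := h1.eq_of_eventuallyEq h2 (z₀ := 1 - w.re) (by
      filter_upwards [lt_mem_nhds (show -w.re < 1 - w.re by linarith)] with t ht
      exact hpos _ (by simp; linarith))
    simpa using congrFun h3 0
  by_cases h0 : w.im = 0
  -- The real axis contains the poles, so a real point is reached vertically, by continuity.
  · have hw' : ∀ m : ℕ, w + (0 : ℝ) * Complex.I ≠ -m := by simpa using hw
    have h1 := (analyticAt_line M Complex.I 0 (hhol _ hw')).continuousAt.tendsto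
    have h2 := (analyticAt_phi_Gamma_line hM Complex.I 0 hw').continuousAt.tendsto
    have h3 : (fun t : ℝ => G (phi M (w + t * Complex.I))) =ᶠ[𝓝[≠] 0]
        fun t : ℝ => phi M (Complex.Gamma (w + t * Complex.I)) := by
      filter_upwards [self_mem_nhdsWithin] with t ht
      exact him _ (by simpa [h0] using ht)
    simpa using tendsto_nhds_unique_of_eventuallyEq (h1.mono_left nhdsWithin_le_nhds)
      (h2.mono_left nhdsWithin_le_nhds) h3
  · exact him w h0

/-! ### Normally convergent series of words -/

/-- On the ball of radius `r`, the function `F` is the sum of a series of words whose sup norms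
have a sum of at most `B`. -/
def IsWordSum (F : CD v → CD v) (r B : ℝ) : Prop :=
  ∃ (ι : Type) (w : ι → Word v) (b : ι → ℝ), (∀ k, 0 ≤ b k) ∧ Summable b ∧ ∑' k, b k ≤ B ∧
    (∀ k h, ‖h‖ < r → ‖(w k).eval h‖ ≤ b k) ∧
    ∀ h, ‖h‖ < r → HasSum (fun k => (w k).eval h) (F h)

theorem IsWordSum.mono {F : CD v → CD v} {r B B' : ℝ} (h : IsWordSum F r B) (hB : B ≤ B') :
    IsWordSum F r B' := by
  obtain ⟨ι, w, b, h0, h1, h2, h3, h4⟩ := h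
  exact ⟨ι, w, b, h0, h1, h2.trans hB, h3, h4⟩

theorem isWordSum_word (w : Word v) {r B : ℝ} (hB : 0 ≤ B) (h : ∀ h, ‖h‖ < r → ‖w.eval h‖ ≤ B) :
    IsWordSum w.eval r B :=
  ⟨Unit, fun _ => w, fun _ => B, fun _ => hB, (hasSum_fintype _).summable, by simp,
    fun _ => h, fun h _ => hasSum_unique (fun _ : Unit => w.eval h)⟩

theorem isWordSum_const (a : CD v) (r : ℝ) : IsWordSum (fun _ => a) r ‖a‖ :=
  isWordSum_word (.const a) (norm_nonneg a) fun _ _ => le_rfl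

theorem isWordSum_id {r : ℝ} (hr : 0 ≤ r) : IsWordSum (fun h : CD v => h) r r :=
  isWordSum_word .var hr fun _ hh => hh.le

/-- Products of pairs of words form a normally convergent family, which may be summed fibre by
fibre. -/
theorem IsWordSum.mul {F G : CD v → CD v} {r B B' : ℝ} (hF : IsWordSum F r B)
    (hG : IsWordSum G r B') : IsWordSum (fun h => F h * G h) r (‖mulCLM v‖ * B * B') := by
  obtain ⟨ι, w, b, h0, h1, h2, h3, h4⟩ := hF
  obtain ⟨κ, w', b', h0', h1', h2', h3', h4'⟩ := hG
  have hs : Summable fun k : ι × κ => ‖mulCLM v‖ * (b k.1 * b' k.2) :=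
    (h1.mul_of_nonneg h1' h0 h0').mul_left _
  have hn : ∀ (k : ι × κ) h, ‖h‖ < r →
      ‖((w k.1).mul (w' k.2)).eval h‖ ≤ ‖mulCLM v‖ * (b k.1 * b' k.2) := fun k h hh => by
    refine (norm_mul_le' _ _).trans ?_
    rw [mul_assoc]
    have := h3 k.1 h hh
    have := h3' k.2 h hh
    have := h0 k.1
    gcongr
  refine ⟨ι × κ, fun k => (w k.1).mul (w' k.2), _, fun k => ?_, hs, ?_, hn, fun h hh => ?_⟩
  · have := h0 k.1
    have := h0' k.2
    positivity
  · rw [tsum_mul_left, ← h1.tsum_mul_tsum h1' (h1.mul_of_nonneg h1' h0 h0'), mul_assoc]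
    have : 0 ≤ ∑' k, b k := tsum_nonneg h0
    have : 0 ≤ ∑' k, b' k := tsum_nonneg h0'
    have : 0 ≤ B := (tsum_nonneg h0).trans h2
    gcongr
  · have hsum : Summable fun k : ι × κ => ((w k.1).mul (w' k.2)).eval h :=
      Summable.of_norm_bounded hs fun k => hn k h hh
    have e1 := hsum.hasSum.prod_fiberwise fun k => (mulCLM v ((w k).eval h)).hasSum (h4' h hh)
    have e2 := ((mulCLM v).flip (G h)).hasSum (h4 h hh)
    have e3 := e1.unique e2
    have e4 := hsum.hasSum
    rw [e3] at e4
    exact e4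

/-- The explicit bound in `IsWordSum` is there for this: summable bounds make the union of all the
families normally convergent. -/
theorem isWordSum_hasSum {ι : Type} {F : ι → CD v → CD v} {S : CD v → CD v} {r : ℝ} {B : ι → ℝ}
    (hF : ∀ i, IsWordSum (F i) r (B i)) (hB : Summable B)
    (hS : ∀ h, ‖h‖ < r → HasSum (fun i => F i h) (S h)) : IsWordSum S r (∑' i, B i) := by
  choose κ w b h0 h1 h2 h3 h4 using hF
  have hb : Summable fun i => ∑' k, b i k :=
    Summable.of_nonneg_of_le (fun i => tsum_nonneg (h0 i)) h2 hB
  have hs : Summable fun k : Σ i, κ i => b k.1 k.2 :=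
    (summable_sigma_of_nonneg fun k => h0 k.1 k.2).2 ⟨h1, hb⟩
  refine ⟨Σ i, κ i, fun k => w k.1 k.2, fun k => b k.1 k.2, fun k => h0 _ _, hs, ?_,
    fun k => h3 k.1 k.2, fun h hh => ?_⟩
  · rw [hs.tsum_sigma]
    exact hb.tsum_le_tsum h2 hB
  · have hsum : Summable fun k : Σ i, κ i => (w k.1 k.2).eval h :=
      Summable.of_norm_bounded hs fun k => h3 k.1 k.2 h hh
    have e1 := hsum.hasSum.sigma fun i => h4 i h hh
    have e2 := hsum.hasSum
    rw [e1.unique (hS h hh)] at e2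
    exact e2

/-- Finite sums of words of degree one, up to normal convergence on every ball. -/
def IsLinWord (F : CD v → CD v) : Prop :=
  ∃ K : ℝ, 0 ≤ K ∧ ∀ r, 0 < r → IsWordSum F r (K * r)

theorem isLinWord_id : IsLinWord (fun h : CD v => h) :=
  ⟨1, zero_le_one, fun r hr => by simpa using isWordSum_id hr.le⟩

theorem IsLinWord.const_mul {F : CD v → CD v} (hF : IsLinWord F) (a : CD v) :
    IsLinWord (fun h => a * F h) := by
  obtain ⟨K, hK, h⟩ := hF
  exact ⟨‖mulCLM v‖ * ‖a‖ * K, by positivity, fun r hr => by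
    simpa [mul_assoc] using (isWordSum_const a r).mul (h r hr)⟩

theorem IsLinWord.mul_const {F : CD v → CD v} (hF : IsLinWord F) (a : CD v) :
    IsLinWord (fun h => F h * a) := by
  obtain ⟨K, hK, h⟩ := hF
  exact ⟨‖mulCLM v‖ * K * ‖a‖, by positivity, fun r hr =>
    ((h r hr).mul (isWordSum_const a r)).mono (le_of_eq (by ring))⟩

theorem IsLinWord.smul {F : CD v → CD v} (hF : IsLinWord F) (c : ℝ) :
    IsLinWord (fun h => c • F h) := by
  simpa using hF.const_mul (c • (1 : CD v))

theorem IsLinWord.add {F G : CD v → CD v} (hF : IsLinWord F) (hG : IsLinWord G) :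
    IsLinWord (fun h => F h + G h) := by
  obtain ⟨K, hK, h⟩ := hF
  obtain ⟨K', hK', h'⟩ := hG
  refine ⟨K + K', by positivity, fun r hr => ?_⟩
  have := isWordSum_hasSum (F := fun i : Bool => bif i then F else G)
    (S := fun h => F h + G h) (r := r) (B := fun i => bif i then K * r else K' * r)
    (by rintro (_ | _) <;> simp [h r hr, h' r hr]) (hasSum_fintype _).summable
    (fun h _ => by simpa using hasSum_fintype (fun i : Bool => (bif i then F else G) h))
  refine this.mono (le_of_eq ?_)
  simp [add_mul]

/-- From dimension 4 on, the real part is a sum of words. -/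
theorem IsLinWord.realPart {F : CD (v + 2) → CD (v + 2)} (hF : IsLinWord F) :
    IsLinWord (fun h => reL (v + 2) (F h) • (1 : CD (v + 2))) := by
  let l : CD (v + 2) := pair 0 1
  obtain ⟨i, hi⟩ : ∃ i : CD (v + 1), IsUnitIm i := ⟨_, isUnitIm_pair⟩
  let e : CD (v + 2) := pair i 0
  -- For z = a + bl one has (lz)l = -a* - b*l, so P replaces both components by their real parts.
  let P : CD (v + 2) → CD (v + 2) := fun z => (1 / 2 : ℝ) • z + (-(1 / 2) : ℝ) • ((l * z) * l)
  have hP : IsLinWord (fun h => P (F h)) :=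
    (hF.smul _).add (((hF.const_mul l).mul_const l).smul _)
  have hP' : ∀ z, P z = pair (reL _ (left z) • 1) (reL _ (right z) • 1) := fun z => by
    have h1 := add_star (left z)
    have h2 := add_star (right z)
    apply ext_pair
    · have h3 : left (P z) = (1 / 2 : ℝ) • (left z + star (left z)) := by
        simp [P, l, star_one']
      rw [h3, h1, smul_smul, left_pair]; congr 1; ring
    · have h3 : right (P z) = (1 / 2 : ℝ) • (right z + star (right z)) := by
        simp [P, l]
      rw [h3, h2, smul_smul, right_pair]; congr 1; ring
  -- Conjugating x + yl, with x and y real, by the imaginary unit e of the first component flips the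
  -- sign of y; averaging leaves x.
  have hQ : ∀ z : CD (v + 2), reL (v + 2) z • (1 : CD (v + 2)) =
      (1 / 2 : ℝ) • P z + (1 / 2 : ℝ) • (e * (P z * star e)) := fun z => by
    rw [hP']
    apply ext_pair
    · simp only [e, left_smul, left_one, left_add, left_pair, right_pair, left_mul, right_mul,
        left_star, right_star, neg_zero, star_zero', zero_mul, mul_zero, sub_zero, zero_add,
        hi.star_eq, smul_mul_assoc, one_mul, mul_smul_comm, mul_neg, hi.mul_self, neg_neg,
        smul_neg, smul_zero, reL_succ z]
      module
    · simp only [e, right_smul, right_one, right_add, left_pair, right_pair, left_mul, right_mul,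
        left_star, right_star, neg_zero, zero_mul, zero_add, star_neg',
        hi.star_eq, smul_mul_assoc, one_mul, hi.mul_self, neg_neg, smul_neg, add_zero, smul_zero]
      module
  simp_rw [hQ]
  exact (hP.smul _).add (((hP.mul_const _).const_mul _).smul _)

/-- The pairing Re(hc) is nondegenerate since Re(c*c) = ‖c‖², and the dimension is finite. -/
theorem exists_eq_reL_mul (f : CD v →ₗ[ℝ] ℝ) : ∃ c : CD v, ∀ h, f h = reL v (h * c) := by
  let T : CD v →ₗ[ℝ] Module.Dual ℝ (CD v) := ((LinearMap.mul ℝ (CD v)).compr₂ (reL v)).flip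
  have hT : ∀ c h, T c h = reL v (h * c) := fun _ _ => rfl
  have hinj : Function.Injective T := by
    refine (injective_iff_map_eq_zero T).2 fun c hc => ?_
    have h1 : reL v (star c * c) = 0 := by rw [← hT, hc]; rfl
    rw [(mul_star_aux c).2, map_smul, reL_one] at h1
    simpa using h1
  have hsurj := (LinearMap.injective_iff_surjective_of_finrank_eq_finrank
    (Subspace.dual_finrank_eq (K := ℝ) (V := CD v)).symm).1 hinj
  obtain ⟨c, hc⟩ := hsurj f
  exact ⟨c, fun h => by rw [← hT, hc]⟩

theorem isLinWord_functional (f : CD (v + 2) →ₗ[ℝ] ℝ) :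
    IsLinWord (fun h : CD (v + 2) => f h • (1 : CD (v + 2))) := by
  obtain ⟨c, hc⟩ := exists_eq_reL_mul f
  simp_rw [hc]
  exact (isLinWord_id.mul_const c).realPart

/-- The restriction of a multilinear map to the diagonal is a finite sum of words. -/
theorem exists_isWordSum_multilinear (v : ℕ) : ∃ D : ℝ, 0 < D ∧ ∀ r : ℝ, 0 < r → ∀ (n : ℕ)
    (m : ContinuousMultilinearMap ℝ (fun _ : Fin n => CD (v + 2)) (CD (v + 2))),
    IsWordSum (fun h => m fun _ => h) r (‖m‖ * (D * r) ^ n) := by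
  let e := Module.finBasis ℝ (CD (v + 2))
  choose K hK hw using fun s => isLinWord_functional (e.coord s)
  set D := ∑ s, ‖mulCLM (v + 2)‖ * K s * ‖e s‖ with hD
  have hD0 : 0 ≤ D := Finset.sum_nonneg fun s _ => by have := hK s; positivity
  refine ⟨D + 1, by positivity, fun r hr n => ?_⟩
  induction n with
  | zero =>
    intro m
    have h1 : (fun h : CD (v + 2) => m fun _ => h) = fun _ => m 0 := by
      ext h; congr 1; exact Subsingleton.elim _ _
    rw [h1]
    refine (isWordSum_const _ r).mono ?_
    simp
  | succ n ih =>
    intro m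
    -- Expanding the first argument in the basis gives m(h, …, h) = ∑ h_s m(e_s, h, …, h). Each
    -- coordinate h_s is a word sum, at a cost of a factor Dr per degree.
    have hF : ∀ s, IsWordSum (fun h => (e.coord s h • (1 : CD (v + 2))) *
        (m.curryLeft (e s)) fun _ => h) r _ := fun s => (hw s r hr).mul (ih (m.curryLeft (e s)))
    have hS := isWordSum_hasSum (S := fun h => m fun _ => h) hF (hasSum_fintype _).summable
      (fun h _ => by
        have h2 := hasSum_fintype fun s => (e.coord s h • (1 : CD (v + 2))) *
          (m.curryLeft (e s)) fun _ => h
        convert h2 using 1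
        have h3 : (m fun _ => h) = m.curryLeft h fun _ => h := by
          rw [ContinuousMultilinearMap.curryLeft_apply]
          congr 1
          ext i
          exact Fin.cases rfl (fun _ => rfl) i
        have h4 : m.curryLeft h = ∑ s, e.repr h s • m.curryLeft (e s) := by
          simp only [← map_smul, ← map_sum, e.sum_repr]
        rw [h3, h4, _root_.sum_apply]
        simp only [_root_.smul_apply, smul_mul_assoc, one_mul,
          Module.Basis.coord_apply])
    refine hS.mono ?_
    rw [tsum_fintype]
    calc _ ≤ ∑ s, ‖mulCLM (v + 2)‖ * (K s * r) * (‖m‖ * ‖e s‖ * ((D + 1) * r) ^ n) := by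
          refine Finset.sum_le_sum fun s _ => ?_
          have := hK s
          have := m.curryLeft.le_opNorm (e s)
          rw [ContinuousMultilinearMap.curryLeft_norm] at this
          gcongr
      _ = D * (‖m‖ * r * ((D + 1) * r) ^ n) := by
          rw [hD, Finset.sum_mul]
          exact Finset.sum_congr rfl fun s _ => by ring
      _ ≤ (D + 1) * (‖m‖ * r * ((D + 1) * r) ^ n) := by gcongr; linarith
      _ = _ := by ring

/-- From dimension 4 on, real analytic functions are holomorphic, because conjugation is a sum
of words. -/
theorem holomorphicAt_of_analyticAt {f : CD (v + 2) → CD (v + 2)} {z₀ : CD (v + 2)}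
    (hf : AnalyticAt ℝ f z₀) : HolomorphicAt f z₀ := by
  obtain ⟨p, R, hp⟩ := hf
  obtain ⟨D, hD, hw⟩ := exists_isWordSum_multilinear v
  obtain ⟨ρ, hρ0, hρ⟩ := ENNReal.lt_iff_exists_nnreal_btwn.1 hp.r_pos
  have hρ0 : (0 : ℝ) < ρ := by exact_mod_cast hρ0
  -- With Dr ≤ ρ, the cost D per degree is absorbed by the convergence of ∑ ‖p n‖ ρ^n.
  set r := min (ρ : ℝ) (ρ / D) with hr
  have hr0 : 0 < r := lt_min hρ0 (by positivity)
  have hDr : D * r ≤ ρ := by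
    have := min_le_right (ρ : ℝ) (ρ / D)
    rwa [le_div_iff₀' hD] at this
  have hs : Summable fun n => ‖p n‖ * (D * r) ^ n :=
    (p.summable_norm_mul_pow (hρ.trans_le hp.r_le)).of_nonneg_of_le
      (fun n => by positivity) (fun n => by gcongr)
  obtain ⟨ι, w, b, h0, h1, h2, h3, h4⟩ := isWordSum_hasSum (S := fun h => f (z₀ + h))
    (fun n => hw r hr0 n (p n)) hs (fun h hh => hp.hasSum (by
      rw [Metric.mem_eball, edist_zero_right]
      refine lt_of_lt_of_le ?_ hρ.le
      have : ‖h‖ < ρ := hh.trans_le (min_le_left _ _)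
      rw [← ofReal_norm, ENNReal.ofReal_lt_coe_iff (by positivity)]
      exact this))
  exact ⟨r, hr0, ι, w, b, h1, h3, h4⟩

/-! ### Existence of the Gamma function -/

/-- The complex Gamma function transplanted to every plane `ℝ ⊕ N ℝ`. -/
def gammaFun (z : CD v) : CD v :=
  let w : ℂ := ⟨reL v z, ‖z - reL v z • (1 : CD v)‖⟩
  (Complex.Gamma w).re • (1 : CD v) +
    ((Complex.Gamma w).im / w.im) • (z - reL v z • (1 : CD v))

/-- `gammaFun` takes the nonnegative imaginary coordinate; Γ(conj w) = conj Γ(w) makes this choice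
harmless. At real w the quotient is 0/0 = 0. -/
theorem gammaFun_phi (hM : IsUnitIm M) (w : ℂ) :
    gammaFun (phi M w) = phi M (Complex.Gamma w) := by
  have h1 : phi M w - reL v (phi M w) • (1 : CD v) = w.im • M := by
    rw [reL_phi hM, phi_apply]; abel
  have h2 : ‖w.im • M‖ = |w.im| := by rw [norm_smul, hM.2, mul_one, Real.norm_eq_abs]
  simp only [gammaFun, h1, h2]
  rw [reL_phi hM, smul_smul, phi_apply]
  rcases lt_trichotomy w.im 0 with h | h | h
  · have h3 : (⟨w.re, |w.im|⟩ : ℂ) = starRingEnd ℂ w := by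
      apply Complex.ext <;> simp [abs_of_neg h]
    rw [h3, Complex.Gamma_conj, Complex.conj_re, Complex.conj_im, abs_of_neg h,
      neg_div_neg_eq, div_mul_cancel₀ _ h.ne]
  · have h3 : (⟨w.re, |w.im|⟩ : ℂ) = w := by apply Complex.ext <;> simp [h]
    have h4 : (Complex.Gamma w).im = 0 := by
      have : w = (w.re : ℂ) := by apply Complex.ext <;> simp [h]
      rw [this, Complex.Gamma_ofReal, Complex.ofReal_im]
    rw [h3, h4, zero_div, zero_mul]
  · have h3 : (⟨w.re, |w.im|⟩ : ℂ) = w := by apply Complex.ext <;> simp [abs_of_pos h]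
    rw [h3, abs_of_pos h, div_mul_cancel₀ _ h.ne']

/-- The word `h ^ n`. -/
def powWord (v : ℕ) : ℕ → Word v
  | 0 => .const 1
  | n + 1 => .mul (powWord v n) .var

theorem powWord_eval (h : CD v) : ∀ n, (powWord v n).eval h = npow h n
  | 0 => rfl
  | n + 1 => by rw [powWord, Word.eval, powWord_eval h n]; rfl

/-- A Taylor expansion of the complex Gamma function gives a series of words where its coefficients
make sense in all the planes that are involved. -/
theorem holomorphicAt_gammaFun_of_taylor {z₀ : CD v} {w₀ : ℂ} {c : ℕ → ℂ} {r : ℝ} (hr : 0 < r)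
    (hs : Summable fun n => ‖c n‖ * r ^ n)
    (hc : ∀ h : ℂ, ‖h‖ < r → HasSum (fun n => c n * h ^ n) (Complex.Gamma (w₀ + h)))
    {C : ℕ → CD v} (hC : ∀ h : CD v, ∃ (N : CD v) (w : ℂ), IsUnitIm N ∧ h = phi N w ∧
      z₀ = phi N w₀ ∧ ∀ n, C n = phi N (c n)) : HolomorphicAt gammaFun z₀ := by
  have key : ∀ (N : CD v) (w : ℂ) n, IsUnitIm N → C n = phi N (c n) →
      ((Word.const (C n)).mul (powWord v n)).eval (phi N w) = phi N (c n * w ^ n) :=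
    fun N w n hN hn => by
      rw [Word.eval, powWord_eval, Word.eval, hn, npow_phi hN, phi_mul hN]
  refine ⟨r, hr, ℕ, fun n => (Word.const (C n)).mul (powWord v n), _, hs, fun n h hh => ?_,
    fun h hh => ?_⟩
  · obtain ⟨N, w, hN, rfl, -, hn⟩ := hC h
    rw [norm_phi hN] at hh
    rw [key N w n hN (hn n), norm_phi hN, norm_mul, norm_pow]
    gcongr
  · obtain ⟨N, w, hN, rfl, rfl, hn⟩ := hC h
    rw [norm_phi hN] at hh
    simp_rw [fun n => key N w n hN (hn n)]
    rw [← map_add, gammaFun_phi hN]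
    exact hasSum_phi hN (hc w hh)

theorem exists_taylor_Gamma {w₀ : ℂ} (hw : ∀ m : ℕ, w₀ ≠ -m) : ∃ (c : ℕ → ℂ) (r : ℝ), 0 < r ∧
    (Summable fun n => ‖c n‖ * r ^ n) ∧
    ∀ h : ℂ, ‖h‖ < r → HasSum (fun n => c n * h ^ n) (Complex.Gamma (w₀ + h)) := by
  obtain ⟨p, R, hp⟩ := analyticAt_Gamma hw
  obtain ⟨ρ, hρ0, hρ⟩ := ENNReal.lt_iff_exists_nnreal_btwn.1 hp.r_pos
  refine ⟨p.coeff, ρ, by exact_mod_cast hρ0, ?_, fun h hh => ?_⟩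
  · simpa using p.summable_norm_mul_pow (hρ.trans_le hp.r_le)
  · have := hp.hasSum (y := h) (by
      rw [Metric.mem_eball, edist_zero_right]
      refine lt_of_lt_of_le ?_ hρ.le
      rw [← ofReal_norm, ENNReal.ofReal_lt_coe_iff (by positivity)]
      exact hh)
    simpa [mul_comm] using this

/-- Averaging the Taylor series with its conjugate makes the coefficients real, and real
coefficients lie in every plane. -/
theorem holomorphicAt_gammaFun_real {x : ℝ} (hx : ∀ m : ℕ, (x : ℂ) ≠ -m) :
    HolomorphicAt gammaFun (ofReal (v + 1) x) := by
  obtain ⟨c, r, hr, hs, hc⟩ := exists_taylor_Gamma hx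
  refine holomorphicAt_gammaFun_of_taylor (w₀ := x) (c := fun n => ((c n).re : ℂ)) hr
    (hs.of_nonneg_of_le (fun n => by positivity) fun n => ?_) (fun h hh => ?_)
    (C := fun n => ofReal (v + 1) (c n).re) fun h => ?_
  · gcongr
    rw [Complex.norm_real]
    exact Complex.abs_re_le_norm _
  · have h1 := hc h hh
    have h2 := hc (starRingEnd ℂ h) (by simpa using hh)
    replace h2 := Complex.conjCLE.hasSum'.2 h2
    simp only [Complex.conjCLE_apply] at h2
    have h3 := (h1.add h2).div_const 2
    have h4 : (x : ℂ) + starRingEnd ℂ h = starRingEnd ℂ (x + h) := by simp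
    rw [h4, Complex.Gamma_conj, Complex.conj_conj, add_self_div_two] at h3
    refine h3.congr_fun fun n => ?_
    rw [map_mul, map_pow, Complex.conj_conj, ← add_mul, Complex.add_conj]
    push_cast; ring
  · obtain ⟨N, w, hN, hw⟩ := exists_phi h
    exact ⟨N, w, hN, hw, (phi_ofReal N x).symm, fun n => (phi_ofReal N _).symm⟩

theorem exists_eq_phi_one (h : CD 1) : ∃ w : ℂ, h = phi (pair 0 1) w := by
  have h1 : ∀ x : CD 0, reL 0 x • (1 : CD 0) = x := fun x => _root_.mul_one (M := ℝ) x
  refine ⟨⟨reL 0 (left h), reL 0 (right h)⟩, ?_⟩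
  exact ext_pair (by simp [phi_apply, h1]) (by simp [phi_apply, h1])

theorem holomorphicAt_gammaFun_one {w₀ : ℂ} (hw : ∀ m : ℕ, w₀ ≠ -m) :
    HolomorphicAt gammaFun (phi (pair 0 1 : CD 1) w₀) := by
  obtain ⟨c, r, hr, hs, hc⟩ := exists_taylor_Gamma hw
  refine holomorphicAt_gammaFun_of_taylor hr hs hc (C := fun n => phi (pair 0 1) (c n))
    fun h => ?_
  obtain ⟨w, hw⟩ := exists_eq_phi_one h
  exact ⟨pair 0 1, w, isUnitIm_pair, hw, rfl, fun _ => rfl⟩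

/-- Off the real axis the norm of the imaginary part is analytic: its square is a positive
polynomial, and the root is exp(log / 2). -/
theorem analyticAt_gammaFun {w₀ : ℂ} (him : w₀.im ≠ 0) (hM : IsUnitIm M) :
    AnalyticAt ℝ gammaFun (phi M w₀) := by
  let ρ : CD v →L[ℝ] ℝ := LinearMap.toContinuousLinearMap (reL v)
  let Y : CD v →L[ℝ] CD v := ContinuousLinearMap.id ℝ _ - ρ.smulRight (1 : CD v)
  have hρ : ∀ z, ρ z = reL v z := fun _ => rfl
  have hY : ∀ z, Y z = z - reL v z • (1 : CD v) := fun _ => rfl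
  have hY0 : Y (phi M w₀) = w₀.im • M := by rw [hY, reL_phi hM, phi_apply]; abel
  have hY1 : ‖Y (phi M w₀)‖ ≠ 0 := by
    rw [hY0, norm_smul, hM.2, mul_one]; exact norm_ne_zero_iff.2 him
  have hsq : ∀ y : CD v, ‖y‖ ^ 2 = -ρ (y * y) + 2 * ρ y * ρ y := fun y => by
    have h1 := congrArg (reL v) (mul_star y)
    rw [star_eq, mul_sub, map_sub, mul_smul_comm, mul_one, map_smul, map_smul, reL_one] at h1
    simp only [smul_eq_mul] at h1
    rw [hρ, hρ]; linarith
  have hN : AnalyticAt ℝ (fun z => ‖Y z‖) (phi M w₀) := by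
    have h1 : AnalyticAt ℝ (fun z => ‖Y z‖ ^ 2) (phi M w₀) := by
      simp_rw [hsq]
      have hy := Y.analyticAt (phi M w₀)
      have hry := (ρ.comp Y).analyticAt (phi M w₀)
      have hm : AnalyticAt ℝ (fun z => Y z * Y z) (phi M w₀) :=
        ((mulCLM v).analyticAt_bilinear (Y (phi M w₀), Y (phi M w₀))).comp_of_eq
          (hy.prod hy) rfl
      exact ((ρ.analyticAt _).comp_of_eq hm rfl).neg.add ((analyticAt_const.mul hry).mul hry)
    have h0 : 0 < ‖Y (phi M w₀)‖ ^ 2 := by positivity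
    have h2 := (((analyticAt_log h0).comp_of_eq h1 rfl).div_const (c := (2 : ℝ))).rexp'
    refine h2.congr ?_
    have h3 : ∀ᶠ z in 𝓝 (phi M w₀), ‖Y z‖ ≠ 0 :=
      (Y.continuous.norm.continuousAt).eventually_ne hY1
    filter_upwards [h3] with z hz
    rw [Function.comp_apply, Real.log_pow, Nat.cast_ofNat, mul_div_cancel_left₀ _ two_ne_zero,
      Real.exp_log (lt_of_le_of_ne (norm_nonneg _) hz.symm)]
  have hW : AnalyticAt ℝ (fun z : CD v => (⟨ρ z, ‖Y z‖⟩ : ℂ)) (phi M w₀) := by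
    have h1 := ((Complex.ofRealCLM.analyticAt _).comp (ρ.analyticAt (phi M w₀))).add
      (((Complex.ofRealCLM.analyticAt _).comp hN).mul (analyticAt_const (v := Complex.I)))
    refine h1.congr (Eventually.of_forall fun z => ?_)
    apply Complex.ext <;> simp
  have hΓ : AnalyticAt ℝ (fun z : CD v => Complex.Gamma ⟨ρ z, ‖Y z‖⟩) (phi M w₀) := by
    refine AnalyticAt.comp_of_eq ((analyticAt_Gamma ?_).restrictScalars (𝕜 := ℝ)) hW rfl
    exact fun m h => hY1 (by simpa using congrArg Complex.im h)
  have hre := (Complex.reCLM.analyticAt _).comp hΓ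
  have him' := ((Complex.imCLM.analyticAt _).comp hΓ).div hN hY1
  exact (hre.smul analyticAt_const).add (him'.smul (Y.analyticAt _))

/-- At a non-real point the Taylor coefficients and the increment need not share a plane. They do in
`CD 1`, which is a single plane; in higher dimension real analyticity replaces the Taylor argument.
-/
theorem isGammaFunction_gammaFun : IsGammaFunction (gammaFun : CD (v + 1) → CD (v + 1)) := by
  refine ⟨fun z hz => ?_, fun z hz => ?_⟩
  · obtain ⟨N, w, hN, rfl⟩ := exists_phi z
    rw [integral_gammaIntegrand hN (re_pos_of_integrableOn hN hz), gammaFun_phi hN]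
  · have hpole : ∀ (N : CD (v + 1)) (w : ℂ), z = phi N w → ∀ m : ℕ, w ≠ -m :=
      fun N w hzw m h => hz m (by rw [hzw, h, ← phi_ofReal N]; push_cast; rfl)
    cases v with
    | zero =>
      obtain ⟨w, hw⟩ := exists_eq_phi_one z
      rw [hw]
      exact holomorphicAt_gammaFun_one (hpole _ _ hw)
    | succ v =>
      obtain ⟨N, w, hN, hw⟩ := exists_phi z
      have hp := hpole _ _ hw
      rw [hw]
      by_cases him : w.im = 0
      · have hwr : w = (w.re : ℂ) := by apply Complex.ext <;> simp [him]
        rw [hwr] at hp ⊢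
        rw [phi_ofReal]
        exact holomorphicAt_gammaFun_real hp
      · exact holomorphicAt_of_analyticAt (analyticAt_gammaFun him hN)

/-! ### Conclusion -/

theorem Gamma_phi {M : CD (v + 1)} (hM : IsUnitIm M) {w : ℂ} (hw : ∀ m : ℕ, w ≠ -m) :
    Gamma (phi M w) = phi M (Complex.Gamma w) := by
  have h : ∃ G : CD (v + 1) → CD (v + 1), IsGammaFunction G := ⟨_, isGammaFunction_gammaFun⟩
  rw [Gamma, dif_pos h]
  exact h.choose_spec.apply_phi hM hw

/-- Hankel's integral for the Gamma function on a plane `ℝ ⊕ M ℝ`. -/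
theorem Gamma_eq_hankel_integral {M : CD v} (hM : IsUnitIm M) {w : ℂ}
    (hw : ∀ m : ℤ, w ≠ m) : Gamma (phi M w) = (((2 : ℝ) • sin (Real.pi • phi M w))⁻¹ *
      phi M (2 * Complex.I * Complex.sin (Real.pi * w) * Complex.Gamma w)) * star M := by
  cases v with
  | zero =>
    -- In ℝ the only imaginary number is 0, so there is no unit M.
    have h0 : M = 0 := hM.1
    have h1 := hM.2
    rw [h0, norm_zero] at h1
    exact absurd h1 zero_ne_one
  | succ v =>
    rw [Gamma_phi hM fun m => by simpa using hw (-m), ← map_smul, sin_phi hM, ← map_smul,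
      inv_phi hM, hM.star_eq]
    -- M* corresponds to -i, which cancels the i in 2i sin(πw) Γ(w).
    have hneg : -M = phi M (-Complex.I) := by rw [map_neg, phi_I]
    rw [hneg, ← phi_mul hM, ← phi_mul hM]
    have hsin : Complex.sin (Real.pi * w) ≠ 0 := by
      intro h
      obtain ⟨k, hk⟩ := Complex.sin_eq_zero_iff.1 h
      have hpi : (Real.pi : ℂ) ≠ 0 := by exact_mod_cast Real.pi_ne_zero
      exact hw k (mul_left_cancel₀ hpi (by rw [hk]; ring))
    congr 1
    rw [Complex.real_smul, Complex.real_smul]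
    push_cast
    field_simp
    rw [Complex.I_sq]; ring

end CayleyDickson

end

theorem corollary13 (v : ℕ) (M : CayleyDickson.CD v) (hM : M ∈ CayleyDickson.imaginary v)
    (hM1 : ‖M‖ = 1) (ψ : CayleyDickson.HankelLoop M) (z : CayleyDickson.CD v)
    (hz : z ∈ CayleyDickson.slice M) (hzint : ∀ n : ℤ, z ≠ CayleyDickson.ofReal v (n : ℝ)) :
    ∃ I : CayleyDickson.CD v,
      CayleyDickson.HasImproperLineIntegral
        (fun t => CayleyDickson.exp (ψ.path t) * ψ.cpow (z - 1) t) ψ.path I ∧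
      CayleyDickson.Gamma z =
        (((2 : ℝ) • CayleyDickson.sin (Real.pi • z))⁻¹ * I) * star M := by
  have hu : CayleyDickson.IsUnitIm M := ⟨CayleyDickson.mem_imaginary_iff.1 hM, hM1⟩
  obtain ⟨x, y, hxy⟩ := hz
  -- The description of a point of the slice unfolds to `phi M ⟨x, y⟩` by definition.
  obtain rfl : z = CayleyDickson.phi M ⟨x, y⟩ := hxy
  generalize (⟨x, y⟩ : ℂ) = w at *
  have hw : ∀ m : ℤ, w ≠ m := fun m h =>
    hzint m (by rw [h, ← CayleyDickson.phi_ofReal M]; push_cast; rfl)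
  exact ⟨_, ψ.hasImproperLineIntegral hu hw, CayleyDickson.Gamma_eq_hankel_integral hu hw⟩
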